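/- Let $n,N\ge 1$ and let $|\cdot|$ be the Euclidean norm on $\mathbb R^n$. Consider the Euler--Lagrange system $M(q)\ddot q+C(q,\dot q)\dot q+N(q,\dot q)=u$ on $\mathbb R^n$, where $M$ is continuously differentiable and symmetric, $\mu_{m1}I<M(q)<\mu_{m2}I$ for all $q$ with positive constants $\mu_{m1},\mu_{m2}$, and $\dot M-2C$ is skew-symmetric (with $\dot M$ the derivative of $M$ at $q$ in the direction $\dot q$, for all $q,\dot q$). Let $q_{oi}\in\mathbb R^n$, $d_{si}>0$ ($i=1,\dots,N$), $h_i(q)=|q_{oi}-q|-d_{si}$, $l_{oi}(q)=(q_{oi}-q)/|q_{oi}-q|$, $\underline d_s=\min_i d_{si}$, $\overline d_s=\max_i d_{si}$. Assume that $0<d_a<\underline d_s$, $d_b>0$, $0<d_h<\underline d_s$ are such that whenever $h_i(q)\ge -d_h$ for all $i$ and $h_j(q)\le d_b/2$, $h_k(q)\le d_b/2$, then $|q_{oj}-q_{ok}|\le d_a$. Let $v_c^d>0$ be a bound for $|\dot v_c|$, where $v_c$ is the velocity command, and let $d_r>0$ and $\bar v$ satisfy $$\sqrt2\,\underline d_s>d_a,\qquad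 \bar v>2d_r,\qquad \frac{2\underline d_s^2-d_a^2}{2(\overline d_s+d_b/2)^2}>1-\frac{(\bar v-2d_r)^2}{2(\bar v-d_r)^2}.$$ Put $c^*=\dfrac{(2\overline d_s+d_b)^2-4\underline d_s^2+2d_a^2}{2(2\overline d_s+d_b)^2}$ and $\kappa=\sqrt{c^*+\frac{d_r}{\bar v-d_r}}-\sqrt{c^*}$. A class $\mathcal K^e$ function is a continuous strictly increasing $\alpha:\mathbb R\to\mathbb R$ with $\alpha(0)=0$. Call $(c_0,\phi,\alpha_c,d_f,\mathcal L)$ admissible if: $0<c_0<1$; $\mathcal L\subset\mathbb R^n$ is a finite set of unit vectors such that for every unit vector $l_o$ the set $\{l\in\mathcal L: l^Tl_o\ge c_0\}$ has at least $n$ elements and $l_o$ is a combination of them with nonnegative coefficients; $\phi:[-1,1]\to[0,\infty)$ is Lipschitz and nonincreasing; $\alpha_c$ is a Lipschitz class $\mathcal K^e$ bijection of $\mathbb R$ with Lipschitz inverse; $d_f>0$; and $$c_0>\sqrt{c^*}+\sqrt{c^*+\tfrac{d_r}{\bar v-d_r}},\qquad c_0(\bar v-d_r)\ge c_0\alpha_c(\tfrac{d_b}2)-d_r>\frac{d_r-c_0\alpha_c(-d_h)}{\kappa},$$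 $$\phi(s)>\max_{p\in[0,d_h]}\ \max_{K\in\{c_0(\bar v-d_r),\,(d_r-c_0\alpha_c(-p))/\kappa\}}\Big\{\alpha_c^{-1}\Big(\frac{-K(s-c_0)}{c_0}+\frac{-K\kappa+d_r}{c_0}\Big)+p\Big\}\ \ (s\in[-1,c_0)),\qquad \phi(s)=0\ \ (s\in[c_0,1]),$$ $$\alpha_c^{-1}\Big(\frac{-c_0\alpha_c(-d_h)+(1+\kappa)d_r}{c_0\,\kappa}\Big)<d_f\le\alpha_c^{-1}\Big(\bar v+\big(\tfrac1{c_0}-1\big)d_r\Big).$$ For such data let $J(q)=\{i:h_i(q)\le d_f\}$ and, for $l\in\mathcal L$, $r(q,l)=\min\{\min_{i\in J(q)}(h_i(q)+\phi(l_{oi}(q)^Tl)),\,d_f\}$ if $J(q)\ne\emptyset$ and $r(q,l)=d_f$ otherwise. Let $\varphi(q,v_c)$ be the solution of the reduced quadratic program: minimize $|v^*-v_c|^2$ over $v^*\in\mathbb R^n$ subject to $l^Tv^*\le c_0\alpha_c(r(q,l))-d_r$ for all $l\in\mathcal L$. Then admissible data exist, and for all admissible data there is $\Delta_h\in(0,d_h]$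 such that: (i) For all $q$ with $h_i(q)\ge-\Delta_h$ for all $i$, and all $v_c\in\mathbb R^n$, the reduced quadratic program has exactly one solution, and there is $L>0$ with $$|\varphi(q_1,v_{c1})-\varphi(q_2,v_{c2})|\le L(|q_1-q_2|+|v_{c1}-v_{c2}|)$$ for all $v_{c1},v_{c2}\in\mathbb R^n$ and all $q_1,q_2$ with $\min\{h_i(q_1),h_i(q_2)\}\ge-\Delta_h$ for all $i$. (ii) Let $L>0$ be any constant as in (i), and let $k_D>2nL\dfrac{\mu_{m2}^3(v_c^d+\bar v)}{\mu_{m1}^2d_r}$. Let $W=\max\{W_1,\dots,W_{N+1}\}$, where $W_i=-h_i(q)$ for $i\le N$ and $$W_{N+1}(q,\dot q,v_c)=-\frac{nL\mu_{m1}\mu_{m2}^2(v_c^d+\bar v-d_r)d_r}{\mu_{m1}k_D-2nL\mu_{m2}^2}+\tfrac12(\dot q-\varphi(q,v_c))^TM(q)(\dot q-\varphi(q,v_c)).$$ Then there are a Lipschitz class $\mathcal K^e$ function $\alpha_w$ and a constant $d_w>0$ such that for all $q,\dot q,v_c\in\mathbb R^n$ with $W(q,\dot q,v_c)\le d_w$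 the function $W$ is Lipschitz near $(q,\dot q,v_c)$ and $$\delta^T[\dot q;\ddot q;\dot v_c]\le-\alpha_w(W(q,\dot q,v_c))\qquad\text{for all }\delta\in\partial W(q,\dot q,v_c),$$ where $\partial W$ is Clarke's generalized gradient, $\dot v_c$ is any vector with $|\dot v_c|\le v_c^d$, and $\ddot q$ is the acceleration of the closed loop with $u=N(q,\dot q)+C(q,\dot q)v^*-k_D(\dot q-v^*)$, $v^*=\varphi(q,v_c)$. -/

import Mathlib

open Filter Topology

noncomputable section

/-- The space `ℝⁿ` with the Euclidean norm. -/
abbrev Vec (n : ℕ) := EuclideanSpace ℝ (Fin n)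

/-- Matrix-vector product on `ℝⁿ`. -/
def matVec {n : ℕ} (A : Matrix (Fin n) (Fin n) ℝ) (x : Vec n) : Vec n :=
  WithLp.toLp 2 (A.mulVec x.ofLp)

/-- Class `K^e`: continuous strictly increasing functions `ℝ → ℝ` vanishing at `0`. -/
structure IsClassKe (α : ℝ → ℝ) : Prop where
  continuous : Continuous α
  strictMono : StrictMono α
  map_zero : α 0 = 0

/-- (Globally) Lipschitz functions `ℝ → ℝ`. -/
def IsLipschitz (α : ℝ → ℝ) : Prop := ∃ K : NNReal, LipschitzWith K α

/-! ### Generalized gradients -/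

section Clarke

variable {F : Type*} [NormedAddCommGroup F] [NormedSpace ℝ F]

/-- Generalized directional derivative: the upper limit of `(f (y + t v) - f y) / t`
as `y → x` and `t ↓ 0`, with values in `[-∞, ∞]` (it is finite when `f` is Lipschitz near `x`). -/
def genDirDeriv (f : F → ℝ) (x v : F) : EReal :=
  Filter.limsup (fun p : F × ℝ => (((f (p.1 + p.2 • v) - f p.1) / p.2 : ℝ) : EReal))
    (𝓝 x ×ˢ 𝓝[>] (0 : ℝ))

/-- Generalized gradient. A vector `δ` is represented by the linear functional `v ↦ δᵀ v`. -/
def genGradient (f : F → ℝ) (x : F) : Set (F →L[ℝ] ℝ) :=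
  {δ | ∀ v : F, ((δ v : ℝ) : EReal) ≤ genDirDeriv f x v}

/-- `f` is Lipschitz on a neighbourhood of `x`. -/
def LipschitzNear (f : F → ℝ) (x : F) : Prop :=
  ∃ K : NNReal, ∃ U ∈ 𝓝 x, LipschitzOnWith K f U

end Clarke

/-! ### The Euler-Lagrange system -/

/-- Coefficients of `M(q) q̈ + C(q, q̇) q̇ + N(q, q̇) = u`. -/
structure ELSystem (n : ℕ) where
  /-- inertia matrix -/
  M : Vec n → Matrix (Fin n) (Fin n) ℝ
  /-- Coriolis and centrifugal matrix -/
  C : Vec n → Vec n → Matrix (Fin n) (Fin n) ℝ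
  /-- resistance and gravity terms -/
  Nf : Vec n → Vec n → Vec n

/-- The derivative `Ṁ` of the inertia matrix at position `q` with velocity `qd`. -/
def ELSystem.Mdot {n : ℕ} (S : ELSystem n) (q qd : Vec n) : Matrix (Fin n) (Fin n) ℝ :=
  Matrix.of fun i j => fderiv ℝ (fun x => S.M x i j) q qd

/-- Structural properties of an Euler-Lagrange system: `M` is continuously differentiable,
`Ṁ - 2C` is skew-symmetric, and `M` is symmetric with `μ₁ I < M(q) < μ₂ I`. -/
structure ELSystem.Regular {n : ℕ} (S : ELSystem n) (μ₁ μ₂ : ℝ) : Prop where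
  contDiff : ∀ i j, ContDiff ℝ 1 (fun q => S.M q i j)
  skew : ∀ q qd, (S.Mdot q qd - (2 : ℝ) • S.C q qd)
    + (S.Mdot q qd - (2 : ℝ) • S.C q qd).transpose = 0
  symm : ∀ q, (S.M q).IsSymm
  lower_pos : 0 < μ₁
  upper_pos : 0 < μ₂
  lower : ∀ q, (S.M q - μ₁ • (1 : Matrix (Fin n) (Fin n) ℝ)).PosDef
  upper : ∀ q, (μ₂ • (1 : Matrix (Fin n) (Fin n) ℝ) - S.M q).PosDef

/-- `(q, q̇, q̈)` satisfies the equation of motion under the input `u`. -/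
def ELSystem.Motion {n : ℕ} (S : ELSystem n) (q qd qdd u : Vec n) : Prop :=
  matVec (S.M q) qdd + matVec (S.C q qd) qd + S.Nf q qd = u

/-- Velocity-tracking control law `u = N(q, q̇) + C(q, q̇) v* - k_D (q̇ - v*)`. -/
def ELSystem.trackingInput {n : ℕ} (S : ELSystem n) (kD : ℝ) (q qd vstar : Vec n) : Vec n :=
  S.Nf q qd + matVec (S.C q qd) vstar - kD • (qd - vstar)

/-! ### Ball obstacles -/

/-- `N` ball obstacles in `ℝⁿ`: centres `q_{oi}` and safety margins `d_{si}`. -/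
structure Obstacles (n N : ℕ) where
  /-- obstacle positions -/
  center : Fin N → Vec n
  /-- safety margins -/
  margin : Fin N → ℝ

namespace Obstacles

variable {n N : ℕ} (O : Obstacles n N)

/-- `h_i(q) = |q_{oi} - q| - d_{si}`. -/
def h (i : Fin N) (q : Vec n) : ℝ := ‖O.center i - q‖ - O.margin i

/-- `l_{oi}(q) = (q_{oi} - q) / |q_{oi} - q|`. -/
def dir (i : Fin N) (q : Vec n) : Vec n := ‖O.center i - q‖⁻¹ • (O.center i - q)

/-- The smallest safety margin. -/
def dmin [NeZero N] : ℝ := Finset.univ.inf' Finset.univ_nonempty O.margin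

/-- The largest safety margin. -/
def dmax [NeZero N] : ℝ := Finset.univ.sup' Finset.univ_nonempty O.margin

/-- The distance condition on the obstacles with constants `d_a`, `d_b`, `d_h`. -/
structure DistanceCondition [NeZero N] (da db dh : ℝ) : Prop where
  da_pos : 0 < da
  da_lt : da < O.dmin
  db_pos : 0 < db
  dh_pos : 0 < dh
  dh_lt : dh < O.dmin
  close : ∀ q : Vec n, (∀ i, -dh ≤ O.h i q) →
    ∀ j k, O.h j q ≤ db / 2 → O.h k q ≤ db / 2 → ‖O.center j - O.center k‖ ≤ da

/-- The constant `c*`. -/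
def cstar [NeZero N] (da db : ℝ) : ℝ :=
  ((2 * O.dmax + db) ^ 2 - 4 * O.dmin ^ 2 + 2 * da ^ 2) / (2 * (2 * O.dmax + db) ^ 2)

/-- The constant `√(c* + d_r / (v̄ - d_r)) - √c*`. -/
def gap [NeZero N] (da db dr vbar : ℝ) : ℝ :=
  √(O.cstar da db + dr / (vbar - dr)) - √(O.cstar da db)

/-- The indices of the nearby obstacles, those with `h_i(q) ≤ d_f`. -/
def nearby (df : ℝ) (q : Vec n) : Finset (Fin N) :=
  letI := Classical.decPred fun i => O.h i q ≤ df
  Finset.univ.filter fun i => O.h i q ≤ df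

end Obstacles

/-! ### The outer-loop control law -/

/-- The finite set `B` of unit vectors is a positive basis with constant `c₀`: for every unit
vector `u`, at least `n` elements `l` of `B` satisfy `lᵀ u ≥ c₀`, and `u` is a combination with
nonnegative coefficients of these elements. -/
def IsPosBasis {n : ℕ} (c₀ : ℝ) (B : Finset (Vec n)) : Prop :=
  (∀ l ∈ B, ‖l‖ = 1) ∧
  ∀ u : Vec n, ‖u‖ = 1 →
    n ≤ {l : Vec n | l ∈ B ∧ c₀ ≤ inner ℝ l u}.ncard ∧
    ∃ ρ : Vec n → ℝ, (∀ l ∈ B, 0 ≤ ρ l) ∧ (∀ l ∈ B, ρ l ≠ 0 → c₀ ≤ inner ℝ l u) ∧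
      u = ∑ l ∈ B, ρ l • l

/-- The design parameters of the outer-loop control law. -/
structure Design (n : ℕ) where
  /-- the constant `c₀` -/
  c₀ : ℝ
  /-- the function `φ`, relevant on `[-1, 1]` only -/
  φ : ℝ → ℝ
  /-- the function `α_c` -/
  α : ℝ → ℝ
  /-- the inverse function of `α_c` -/
  αinv : ℝ → ℝ
  /-- the neighbourhood size `d_f` -/
  df : ℝ
  /-- the positive basis -/
  basis : Finset (Vec n)

/-- The requirements on the design parameters. -/
structure Design.Admissible {n N : ℕ} [NeZero N] (D : Design n) (O : Obstacles n N)
    (da db dh dr vbar : ℝ) : Prop where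
  c₀_pos : 0 < D.c₀
  c₀_lt_one : D.c₀ < 1
  basis : IsPosBasis D.c₀ D.basis
  φ_lipschitz : ∃ K : NNReal, LipschitzOnWith K D.φ (Set.Icc (-1) 1)
  φ_nonneg : ∀ s ∈ Set.Icc (-1 : ℝ) 1, 0 ≤ D.φ s
  φ_decreasing : AntitoneOn D.φ (Set.Icc (-1) 1)
  α_classKe : IsClassKe D.α
  α_lipschitz : IsLipschitz D.α
  αinv_left : Function.LeftInverse D.αinv D.α
  αinv_right : Function.RightInverse D.αinv D.α
  αinv_lipschitz : IsLipschitz D.αinv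
  c₀_large : √(O.cstar da db) + √(O.cstar da db + dr / (vbar - dr)) < D.c₀
  α_upper : D.c₀ * D.α (db / 2) - dr ≤ D.c₀ * (vbar - dr)
  α_lower : (dr - D.c₀ * D.α (-dh)) / O.gap da db dr vbar < D.c₀ * D.α (db / 2) - dr
  /- `φ(s)` exceeds the maximum over `p` and `K`, that is, each of the values -/
  φ_large : ∀ s ∈ Set.Ico (-1) D.c₀, ∀ p ∈ Set.Icc 0 dh,
    ∀ K ∈ ({D.c₀ * (vbar - dr), (dr - D.c₀ * D.α (-p)) / O.gap da db dr vbar} : Set ℝ),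
      D.αinv (-K * (s - D.c₀) / D.c₀ + (-K * O.gap da db dr vbar + dr) / D.c₀) + p < D.φ s
  φ_zero : ∀ s ∈ Set.Icc D.c₀ 1, D.φ s = 0
  df_pos : 0 < D.df
  df_lower : D.αinv ((-D.c₀ * D.α (-dh) + (1 + O.gap da db dr vbar) * dr)
      / (D.c₀ * O.gap da db dr vbar)) < D.df
  df_upper : D.df ≤ D.αinv (vbar + (1 / D.c₀ - 1) * dr)

namespace Design

variable {n N : ℕ} (D : Design n) (O : Obstacles n N)

/-- The distance-regularization function built from the nearby obstacles only. -/
def r (q l : Vec n) : ℝ :=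
  if hJ : (O.nearby D.df q).Nonempty then
    min ((O.nearby D.df q).inf' hJ fun i => O.h i q + D.φ (inner ℝ (O.dir i q) l)) D.df
  else D.df

/-- The feasible set of the reduced quadratic program at position `q`. -/
def feasible (dr : ℝ) (q : Vec n) : Set (Vec n) :=
  {v | ∀ l ∈ D.basis, inner ℝ l v ≤ D.c₀ * D.α (D.r O q l) - dr}

/-- `v` solves the reduced quadratic program at position `q` with velocity command `vc`. -/
def IsQPSolution (dr : ℝ) (q vc v : Vec n) : Prop :=
  v ∈ D.feasible O dr q ∧ ∀ w ∈ D.feasible O dr q, ‖v - vc‖ ^ 2 ≤ ‖w - vc‖ ^ 2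

open Classical in
/-- The outer-loop map sending `(q, v_c)` to the solution of the reduced quadratic program
(with value `0` where there is no solution). -/
def outer (dr : ℝ) (q vc : Vec n) : Vec n :=
  if hv : ∃ v, D.IsQPSolution O dr q vc v then hv.choose else 0

/-- The outer-loop map is Lipschitz with constant `L` on `h_i ≥ -Δ_h`, for all commands. -/
def OuterLipschitz (dr Δh L : ℝ) : Prop :=
  ∀ q₁ q₂ : Vec n, (∀ i, -Δh ≤ min (O.h i q₁) (O.h i q₂)) → ∀ v₁ v₂ : Vec n,
    ‖D.outer O dr q₁ v₁ - D.outer O dr q₂ v₂‖ ≤ L * (‖q₁ - q₂‖ + ‖v₁ - v₂‖)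

/-- The offset subtracted in the last component of the Lyapunov-like function. -/
def offset (n : ℕ) (μ₁ μ₂ vcd vbar dr kD L : ℝ) : ℝ :=
  n * L * μ₁ * μ₂ ^ 2 * (vcd + vbar - dr) * dr / (μ₁ * kD - 2 * n * L * μ₂ ^ 2)

/-- The last component of the Lyapunov-like function, at `x = (q, q̇, v_c)`. -/
def Wlast (S : ELSystem n) (μ₁ μ₂ vcd vbar dr kD L : ℝ) (x : Vec n × Vec n × Vec n) : ℝ :=
  -offset n μ₁ μ₂ vcd vbar dr kD L
    + 1 / 2 * inner ℝ (x.2.1 - D.outer O dr x.1 x.2.2)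
        (matVec (S.M x.1) (x.2.1 - D.outer O dr x.1 x.2.2))

/-- The max-type Lyapunov-like function `W` at `x = (q, q̇, v_c)`. -/
def W [NeZero N] (S : ELSystem n) (μ₁ μ₂ vcd vbar dr kD L : ℝ)
    (x : Vec n × Vec n × Vec n) : ℝ :=
  max (Finset.univ.sup' Finset.univ_nonempty fun i => -O.h i x.1)
    (D.Wlast O S μ₁ μ₂ vcd vbar dr kD L x)

end Design

end

/-! Part (i). The constraints of the quadratic program have fixed normals `l ∈ D.basis`; only their
right-hand sides depend on `q`. Projection onto a polyhedron with fixed normals is jointly Lipschitz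
in the right-hand sides and the projected point (`exists_isPolyProj_lipschitz`): it agrees with a
linear map on each of finitely many closed pieces, indexed by linearly independent sets of active
normals. The right-hand sides are Lipschitz in `q` (`Admissible.exists_bound_lipschitz`), so
everything reduces to feasibility.

Feasibility (`Admissible.feasible_nonempty`). Near the safe set, two obstacles within `d_b / 2` are
seen in directions at distance at most `c₀ - κ`, because this exceeds `2√c*`. Hence retreating from
any one of them at speed `K = (d_r - c₀ α(-Δ)) / κ` retreats from all of them; the size of `φ`
relaxes the constraints whose normals do not point towards an obstacle.

Part (ii). The positive basis property bounds every feasible `v` by `v̄ - d_r` and bounds its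
component towards each obstacle (`Admissible.inner_dir_le`). With `e = q̇ - v*`, the rate of `-h_i`
is therefore at most a class-K term minus `d_r` plus `|e|`. By skew-symmetry of `Ṁ - 2C` and the
Lipschitz bound on the outer loop, the energy of `e` has rate at most `-k|e|² + B|e|`, where `k =
k_D - Lμ₂`, `B = Lμ₂A` and `A = v_c^d + v̄ - d_r`. The gain condition places the offset so that near
the level `W = 0` one has `|e| < d_r`, while `|e| > B / k` whenever the energy component is active
(`gain_bounds`). Both kinds of components then obey one linear decay bound `-K W`, and only active
components enter the generalized directional derivative of a maximum (`HasUpperRate.of_max`). -/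

noncomputable section

/-! ### Projection onto polyhedra with fixed normals -/

section Polyhedron

variable {E : Type*} [NormedAddCommGroup E] [InnerProductSpace ℝ E]

/-- Nonnegative combinations of the vectors `a i`, `i ∈ I`. -/
def conicSpan {ι : Type*} (a : ι → E) (I : Finset ι) : Set E :=
  {x | ∃ ρ : ι → ℝ, (∀ i ∈ I, 0 ≤ ρ i) ∧ x = ∑ i ∈ I, ρ i • a i}

/-- Carathéodory's theorem for cones. -/
theorem exists_linearIndepOn_of_mem_conicSpan {ι : Type*} (a : ι → E) (I : Finset ι) {x : E}
    (hx : x ∈ conicSpan a I) :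
    ∃ J : Finset ι, J ⊆ I ∧ LinearIndepOn ℝ a (J : Set ι) ∧ x ∈ conicSpan a J := by
  classical
  induction hn : I.card using Nat.strong_induction_on generalizing I with
  | _ n ih =>
    by_cases hI : LinearIndepOn ℝ a (I : Set ι)
    · exact ⟨I, subset_rfl, hI, hx⟩
    obtain ⟨ρ, hρ, rfl⟩ := hx
    rw [linearIndepOn_finset_iff] at hI
    push Not at hI
    obtain ⟨g₀, hg₀, i₀, hi₀, hgi₀⟩ := hI
    obtain ⟨g, hg, i₁, hi₁, hgi₁⟩ : ∃ g : ι → ℝ, ∑ i ∈ I, g i • a i = 0 ∧ ∃ i ∈ I, 0 < g i := by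
      rcases lt_or_gt_of_ne hgi₀ with h | h
      · exact ⟨-g₀, by simp [hg₀], i₀, hi₀, by simpa using h⟩
      · exact ⟨g₀, hg₀, i₀, hi₀, h⟩
    -- Ratio test: subtracting the multiple `ρ k / g k` of the relation `g` kills the coefficient at
    -- `k`, and minimality of the ratio keeps the others nonnegative.
    obtain ⟨k, hk, hmin⟩ := Finset.exists_min_image (I.filter fun i => 0 < g i)
      (fun i => ρ i / g i) ⟨i₁, by simp [hi₁, hgi₁]⟩
    rw [Finset.mem_filter] at hk
    have hθ : 0 ≤ ρ k / g k := div_nonneg (hρ k hk.1) hk.2.le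
    have hmem : ∑ i ∈ I, ρ i • a i ∈ conicSpan a (I.erase k) := by
      refine ⟨fun i => ρ i - ρ k / g k * g i, fun i hi => ?_, ?_⟩
      · have hiI := Finset.mem_of_mem_erase hi
        rcases lt_or_ge 0 (g i) with h | h
        · have := hmin i (by simp [hiI, h])
          rw [le_div_iff₀ h] at this
          linarith
        · have := mul_nonpos_of_nonneg_of_nonpos hθ h
          linarith [hρ i hiI]
      · have h1 : ∑ i ∈ I, (ρ i - ρ k / g k * g i) • a i = ∑ i ∈ I, ρ i • a i := by
          simp_rw [sub_smul, mul_smul, Finset.sum_sub_distrib, ← Finset.smul_sum, hg]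
          simp
        rw [← h1, ← Finset.add_sum_erase I _ hk.1]
        have : ρ k - ρ k / g k * g k = 0 := by
          rw [div_mul_cancel₀ _ hk.2.ne', sub_self]
        simp [this]
    obtain ⟨J, hJ, hJ'⟩ := ih _ (hn ▸ Finset.card_erase_lt_of_mem hk.1) (I.erase k) hmem rfl
    exact ⟨J, hJ.trans (Finset.erase_subset _ _), hJ'⟩

theorem conicSpan_mono {ι : Type*} (a : ι → E) {I J : Finset ι} (h : J ⊆ I) :
    conicSpan a J ⊆ conicSpan a I := by
  classical
  rintro x ⟨ρ, hρ, rfl⟩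
  refine ⟨fun i => if i ∈ J then ρ i else 0, fun i _ => ?_, ?_⟩
  · dsimp only
    split_ifs with hi
    exacts [hρ i hi, le_rfl]
  · rw [← Finset.sum_subset h]
    · exact Finset.sum_congr rfl fun i hi => by simp [hi]
    · intro i _ hi
      simp [hi]

theorem convex_conicSpan {ι : Type*} (a : ι → E) (I : Finset ι) : Convex ℝ (conicSpan a I) := by
  rintro x ⟨ρ, hρ, rfl⟩ y ⟨σ, hσ, rfl⟩ s t hs ht -
  refine ⟨fun i => s * ρ i + t * σ i, fun i hi => ?_, ?_⟩
  · have := hρ i hi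
    have := hσ i hi
    positivity
  · simp [add_smul, mul_smul, Finset.sum_add_distrib, Finset.smul_sum]

variable {ι : Type*} {a : ι → E} {b : ι → ℝ} {c v : E}

/-- The point `v` is the projection of `c` onto the polyhedron `{w | ∀ i, ⟪a i, w⟫ ≤ b i}`. -/
def IsPolyProj {ι : Type*} (a : ι → E) (b : ι → ℝ) (c v : E) : Prop :=
  (∀ i, inner ℝ (a i) v ≤ b i) ∧
    ∀ w, (∀ i, inner ℝ (a i) w ≤ b i) → inner ℝ (c - v) (w - v) ≤ 0

theorem convex_polyhedron (a : ι → E) (b : ι → ℝ) :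
    Convex ℝ {v | ∀ i, inner ℝ (a i) v ≤ b i} := by
  intro x hx y hy s t hs ht hst i
  rw [inner_add_right, inner_smul_right, inner_smul_right]
  have h1 := mul_le_mul_of_nonneg_left (hx i) hs
  have h2 := mul_le_mul_of_nonneg_left (hy i) ht
  have h3 : s * b i + t * b i = b i := by rw [← add_mul, hst, one_mul]
  linarith

theorem isClosed_polyhedron (a : ι → E) (b : ι → ℝ) :
    IsClosed {v | ∀ i, inner ℝ (a i) v ≤ b i} := by
  simp only [Set.ofPred_forall]
  exact isClosed_iInter fun i => isClosed_le (by fun_prop) continuous_const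

theorem IsPolyProj.unique {w : E} (hv : IsPolyProj a b c v) (hw : IsPolyProj a b c w) :
    v = w := by
  have h1 := hv.2 w hw.1
  have h2 := hw.2 v hv.1
  have h3 : inner ℝ (w - v) (w - v) = inner ℝ (c - v) (w - v) + inner ℝ (c - w) (v - w) := by
    rw [← neg_sub w v, inner_neg_right, ← sub_eq_add_neg, ← inner_sub_left]
    congr 1
    abel
  have h4 : inner ℝ (w - v) (w - v) = 0 :=
    le_antisymm (by linarith) real_inner_self_nonneg
  exact (sub_eq_zero.1 (inner_self_eq_zero.1 h4)).symm

theorem IsPolyProj.of_multipliers (I : Finset ι) (hv : ∀ i, inner ℝ (a i) v ≤ b i)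
    {ρ : ι → ℝ} (hρ : ∀ i ∈ I, 0 ≤ ρ i) (hI : ∀ i ∈ I, inner ℝ (a i) v = b i)
    (hc : c - v = ∑ i ∈ I, ρ i • a i) : IsPolyProj a b c v := by
  refine ⟨hv, fun w hw => ?_⟩
  rw [hc, sum_inner]
  refine Finset.sum_nonpos fun i hi => ?_
  rw [inner_smul_left, inner_sub_right, hI i hi]
  exact mul_nonpos_of_nonneg_of_nonpos (hρ i hi) (sub_nonpos.2 (hw i))

/-- By Carathéodory the cone is a finite union of cones over independent generators, each the image
of a closed orthant under an injective linear map, which is a closed embedding. -/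
theorem isClosed_conicSpan {ι : Type*} (a : ι → E) (I : Finset ι) :
    IsClosed (conicSpan a I) := by
  classical
  have key : ∀ J : Finset ι, LinearIndepOn ℝ a (J : Set ι) → IsClosed (conicSpan a J) := by
    intro J hJ
    have hinj : Function.Injective (Fintype.linearCombination ℝ fun j : J => a j) :=
      (linearIndependent_iff_injective_fintypeLinearCombination).1 hJ
    have hemb := LinearMap.isClosedEmbedding_of_injective (LinearMap.ker_eq_bot.2 hinj)
    have hcl : IsClosed {ρ : J → ℝ | ∀ j, 0 ≤ ρ j} := by
      simp only [Set.ofPred_forall]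
      exact isClosed_iInter fun j => isClosed_le continuous_const (continuous_apply j)
    convert hemb.isClosedMap _ hcl using 1
    ext x
    constructor
    · rintro ⟨ρ, hρ, rfl⟩
      refine ⟨fun j => ρ j, fun j => hρ j j.2, ?_⟩
      rw [Fintype.linearCombination_apply]
      exact Finset.sum_coe_sort J fun i => ρ i • a i
    · rintro ⟨ρ, hρ, rfl⟩
      refine ⟨fun i => if h : i ∈ J then ρ ⟨i, h⟩ else 0, fun i hi => ?_, ?_⟩
      · simpa [hi] using hρ ⟨i, hi⟩
      · rw [Fintype.linearCombination_apply, ← Finset.sum_coe_sort J]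
        exact Finset.sum_congr rfl fun j _ => by simp
  have hU : conicSpan a I = ⋃ J ∈ {J : Finset ι | J ⊆ I ∧ LinearIndepOn ℝ a (J : Set ι)},
      conicSpan a J := by
    ext x
    simp only [Set.mem_iUnion, exists_prop]
    constructor
    · intro hx
      obtain ⟨J, h1, h2, h3⟩ := exists_linearIndepOn_of_mem_conicSpan a I hx
      exact ⟨J, ⟨h1, h2⟩, h3⟩
    · rintro ⟨J, ⟨h1, -⟩, h3⟩
      exact conicSpan_mono a h1 h3
  rw [hU]
  refine Set.Finite.isClosed_biUnion ?_ fun J hJ => key J hJ.2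
  exact I.powerset.finite_toSet.subset fun J hJ => Finset.mem_coe.2 (Finset.mem_powerset.2 hJ.1)

theorem exists_forall_inner_sub_le_zero [FiniteDimensional ℝ E] {C : Set E}
    (hne : C.Nonempty) (hcl : IsClosed C) (hconv : Convex ℝ C) (x : E) : ∃ p ∈ C, ∀ z ∈ C, inner ℝ (x - p) (z - p) ≤ 0 := by
  obtain ⟨p, hp, hmin⟩ := exists_norm_eq_iInf_of_complete_convex hne hcl.isComplete hconv x
  exact ⟨p, hp, (norm_eq_iInf_iff_real_inner_le_zero hconv hp).1 hmin⟩

/-- Farkas' lemma. -/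
theorem exists_separating_of_notMem_conicSpan [FiniteDimensional ℝ E] {ι : Type*} (a : ι → E)
    (I : Finset ι) {x : E} (hx : x ∉ conicSpan a I) : ∃ y, (∀ i ∈ I, inner ℝ (a i) y ≤ 0) ∧ 0 < inner ℝ x y := by
  classical
  -- With `p` the nearest point of the cone, `x - p` separates: testing against `p + a i` gives the
  -- first inequality, testing against `0` the second.
  obtain ⟨p, hp, hmin⟩ := exists_forall_inner_sub_le_zero
    (C := conicSpan a I) ⟨0, 0, by simp, by simp⟩ (isClosed_conicSpan a I) (convex_conicSpan a I) x
  refine ⟨x - p, fun i hi => ?_, ?_⟩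
  · have : p + a i ∈ conicSpan a I := by
      obtain ⟨ρ, hρ, rfl⟩ := hp
      refine ⟨fun j => ρ j + if j = i then 1 else 0, fun j hj => ?_, ?_⟩
      · have := hρ j hj
        dsimp only
        split_ifs <;> linarith
      · simp [add_smul, Finset.sum_add_distrib, hi]
    simpa [real_inner_comm] using hmin _ this
  · have h0 := hmin 0 ⟨0, by simp, by simp⟩
    have hne : x - p ≠ 0 := fun h => hx (sub_eq_zero.1 h ▸ hp)
    have h1 : 0 < inner ℝ (x - p) (x - p) := by
      rw [real_inner_self_eq_norm_sq]
      have := norm_pos_iff.2 hne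
      positivity
    rw [zero_sub, inner_neg_right] at h0
    have h2 : inner ℝ x (x - p) = inner ℝ (x - p) (x - p) + inner ℝ (x - p) p := by
      rw [← inner_add_right, sub_add_cancel, real_inner_comm]
    linarith

theorem exists_isPolyProj [FiniteDimensional ℝ E] (h : ∃ v, ∀ i, inner ℝ (a i) v ≤ b i)
    (c : E) :
    ∃ v, IsPolyProj a b c v := by
  obtain ⟨p, hp, hp'⟩ := exists_forall_inner_sub_le_zero h (isClosed_polyhedron a b)
    (convex_polyhedron a b) c
  exact ⟨p, hp, hp'⟩

/-- The Karush-Kuhn-Tucker conditions. If `c - v` were outside the cone of active normals, Farkas'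
lemma would give a direction `y` that keeps the active constraints and improves the distance; a
short step along `y` also keeps the inactive ones, contradicting optimality. Carathéodory then thins
the active set to an independent one. -/
theorem IsPolyProj.exists_multipliers [FiniteDimensional ℝ E] [Fintype ι] (h : IsPolyProj a b c v) :
    ∃ I : Finset ι, LinearIndepOn ℝ a (I : Set ι) ∧ (∀ i ∈ I, inner ℝ (a i) v = b i) ∧
      c - v ∈ conicSpan a I := by
  classical
  have hmem : c - v ∈ conicSpan a {i | inner ℝ (a i) v = b i} := by
    by_contra hn
    obtain ⟨y, hy, hpos⟩ := exists_separating_of_notMem_conicSpan a _ hn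
    have hev : ∀ᶠ t in 𝓝[>] (0 : ℝ), ∀ i, inner ℝ (a i) (v + t • y) ≤ b i := by
      rw [eventually_all]
      intro i
      rcases (h.1 i).eq_or_lt with hi | hi
      · filter_upwards [self_mem_nhdsWithin] with t ht
        have := hy i (by simp [hi])
        rw [inner_add_right, inner_smul_right, hi]
        have := mul_nonpos_of_nonneg_of_nonpos (le_of_lt ht) this
        linarith
      · have hcont : Continuous fun t : ℝ => (inner ℝ (a i) (v + t • y) : ℝ) := by fun_prop
        have : ∀ᶠ t in 𝓝 (0 : ℝ), (inner ℝ (a i) (v + t • y) : ℝ) < b i :=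
          hcont.continuousAt.eventually_lt_const (by simpa using hi)
        exact (this.filter_mono nhdsWithin_le_nhds).mono fun t ht => ht.le
    obtain ⟨t, ht, ht0⟩ := (hev.and self_mem_nhdsWithin).exists
    have := h.2 _ ht
    rw [add_sub_cancel_left, inner_smul_right] at this
    exact absurd this (not_le.2 (mul_pos ht0 hpos))
  obtain ⟨I, hI, hlin, hc⟩ := exists_linearIndepOn_of_mem_conicSpan a _ hmem
  exact ⟨I, hlin, fun i hi => (Finset.mem_filter.1 (hI hi)).2, hc⟩

/-- For linearly independent active constraints, the multipliers are determined linearly by the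
right-hand side and the projected point. -/
theorem exists_linear_multipliers [Fintype ι] (a : ι → E) (I : Finset ι)
    (hI : LinearIndepOn ℝ a (I : Set ι)) :
    ∃ Λ : ((ι → ℝ) × E) →ₗ[ℝ] (I → ℝ), ∀ b c (ρ : I → ℝ),
      (∀ i : I, inner ℝ (a i) (c - ∑ j, ρ j • a j) = b i) ↔ ρ = Λ (b, c) := by
  classical
  let S : (I → ℝ) →ₗ[ℝ] E := Fintype.linearCombination ℝ fun j : I => a j
  have hS : ∀ ρ, S ρ = ∑ j, ρ j • a j := fun ρ => Fintype.linearCombination_apply ..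
  -- `T` is the Gram operator of the chosen normals, invertible because they are independent;
  -- solving with it makes the multipliers linear in `(b, c)`.
  let T : (I → ℝ) →ₗ[ℝ] (I → ℝ) := LinearMap.pi fun i => (innerₛₗ ℝ (a i)).comp S
  have hT : ∀ ρ i, T ρ i = inner ℝ (a i) (S ρ) := fun ρ i => rfl
  have hinj : Function.Injective T := by
    rw [← LinearMap.ker_eq_bot, LinearMap.ker_eq_bot']
    intro ρ hρ
    have h0 : inner ℝ (S ρ) (S ρ) = 0 := by
      nth_rw 1 [hS]
      rw [sum_inner]
      refine Finset.sum_eq_zero fun i _ => ?_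
      rw [inner_smul_left, ← hT, hρ]
      simp
    have h1 : S ρ = S 0 := by rw [map_zero]; exact inner_self_eq_zero.1 h0
    exact (linearIndependent_iff_injective_fintypeLinearCombination.1 hI) h1
  let R : ((ι → ℝ) × E) →ₗ[ℝ] (I → ℝ) := LinearMap.pi fun i =>
    (innerₛₗ ℝ (a i)).comp (LinearMap.snd ℝ (ι → ℝ) E) -
      (LinearMap.proj (R := ℝ) (φ := fun _ : ι => ℝ) (i : ι)).comp (LinearMap.fst ℝ (ι → ℝ) E)
  have hR : ∀ b c i, R (b, c) i = inner ℝ (a i) c - b i := fun _ _ _ => rfl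
  let e := LinearEquiv.ofInjectiveEndo T hinj
  refine ⟨e.symm.toLinearMap.comp R, fun b c ρ => ?_⟩
  rw [LinearMap.comp_apply, LinearEquiv.coe_coe, LinearEquiv.eq_symm_apply,
    LinearEquiv.coe_ofInjectiveEndo, funext_iff]
  refine forall_congr' fun i => ?_
  rw [hT, hR, hS, inner_sub_right]
  constructor <;> intro h <;> linarith

/-- A map on an interval which is `K`-Lipschitz on each of finitely many closed pieces. -/
theorem norm_sub_le_of_finite_closed_cover {κ : Type*} {F : Type*} [SeminormedAddCommGroup F]
    {f : ℝ → F} {K : ℝ} {Z : κ → Set ℝ} (hZ : ∀ k, IsClosed (Z k))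
    (T : Finset κ) {y : ℝ} (hf : ∀ k ∈ T, ∀ s ∈ Z k, ∀ t ∈ Z k, ‖f s - f t‖ ≤ K * |s - t|) :
    ∀ x ≤ y, Set.Icc x y ⊆ ⋃ k ∈ T, Z k → ‖f x - f y‖ ≤ K * (y - x) := by
  classical
  induction T using Finset.strongInduction with
  | _ T ih =>
    intro x hxy hcov
    obtain ⟨k, hk, hxk⟩ : ∃ k ∈ T, x ∈ Z k := by
      simpa using hcov ⟨le_rfl, hxy⟩
    -- Jump to the last point `s` of a piece containing `x`. This piece never recurs after `s`, so
    -- the remaining pieces cover `(s, y]`, hence by closedness `[s, y]`, and the induction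
    -- continues with one piece fewer.
    obtain ⟨s, ⟨hsk, hs⟩, hsmax⟩ : ∃ s ∈ Z k ∩ Set.Icc x y, ∀ t ∈ Z k ∩ Set.Icc x y, t ≤ s := by
      obtain ⟨s, hs⟩ := (isCompact_Icc.inter_left (hZ k)).exists_isGreatest ⟨x, hxk, le_rfl, hxy⟩
      exact ⟨s, hs.1, hs.2⟩
    have h1 : ‖f x - f s‖ ≤ K * (s - x) := by
      have := hf k hk x hxk s hsk
      rwa [abs_sub_comm, abs_of_nonneg (sub_nonneg.2 hs.1)] at this
    rcases hs.2.eq_or_lt with rfl | hsy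
    · exact h1
    have hcl : IsClosed (⋃ j ∈ T.erase k, Z j) := isClosed_biUnion_finset fun j _ => hZ j
    have hcov' : Set.Icc s y ⊆ ⋃ j ∈ T.erase k, Z j := by
      rw [← closure_Ioc hsy.ne]
      refine closure_minimal (fun t ht => ?_) hcl
      obtain ⟨j, hj, htj⟩ : ∃ j ∈ T, t ∈ Z j := by
        simpa using hcov ⟨hs.1.trans ht.1.le, ht.2⟩
      have hne : j ≠ k := by
        rintro rfl
        exact absurd (hsmax t ⟨htj, hs.1.trans ht.1.le, ht.2⟩) (not_le.2 ht.1)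
      simp only [Set.mem_iUnion]
      exact ⟨j, Finset.mem_erase.2 ⟨hne, hj⟩, htj⟩
    have h2 := ih (T.erase k) (Finset.erase_ssubset hk)
      (fun j hj => hf j (Finset.mem_of_mem_erase hj)) s hs.2 hcov'
    have h3 : ‖f x - f y‖ ≤ ‖f x - f s‖ + ‖f s - f y‖ := norm_sub_le_norm_sub_add_norm_sub ..
    linarith

/-- The projection onto a polyhedron is Lipschitz in the right-hand side of the constraints and in
the projected point. -/
theorem exists_isPolyProj_lipschitz [FiniteDimensional ℝ E] [Fintype ι] (a : ι → E) :
    ∃ K : ℝ, 0 ≤ K ∧ ∀ b₁ b₂ c₁ c₂ v₁ v₂, IsPolyProj a b₁ c₁ v₁ → IsPolyProj a b₂ c₂ v₂ →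
      ‖v₁ - v₂‖ ≤ K * (‖b₁ - b₂‖ + ‖c₁ - c₂‖) := by
  classical
  let 𝓘 := {I : Finset ι // LinearIndepOn ℝ a (I : Set ι)}
  choose Λ hΛ using fun I : 𝓘 => exists_linear_multipliers a I.1 I.2
  let X : 𝓘 → ((ι → ℝ) × E) →L[ℝ] E := fun I => LinearMap.toContinuousLinearMap
    (LinearMap.snd ℝ _ _ - (Fintype.linearCombination ℝ fun j : I.1 => a j).comp (Λ I))
  have hX : ∀ I b c, X I (b, c) = c - ∑ j : I.1, Λ I (b, c) j • a j := fun I b c => by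
    simp [X, Fintype.linearCombination_apply]
  have hproj : ∀ (I : 𝓘) b c, (∀ j, 0 ≤ Λ I (b, c) j) →
      (∀ i, inner ℝ (a i) (X I (b, c)) ≤ b i) → IsPolyProj a b c (X I (b, c)) := by
    intro I b c h1 h2
    refine IsPolyProj.of_multipliers I.1 h2
      (ρ := fun i => if h : i ∈ I.1 then Λ I (b, c) ⟨i, h⟩ else 0) (fun i hi => ?_)
      (fun i hi => ?_) ?_
    · simpa [hi] using h1 ⟨i, hi⟩
    · rw [hX]
      exact (hΛ I b c _).2 rfl ⟨i, hi⟩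
    · rw [hX, sub_sub_cancel, ← Finset.sum_coe_sort I.1]
      exact Finset.sum_congr rfl fun j _ => by simp
  have hex : ∀ b c v, IsPolyProj a b c v → ∃ I : 𝓘, (∀ j, 0 ≤ Λ I (b, c) j) ∧ v = X I (b, c) := by
    intro b c v hv
    obtain ⟨I, hI, hact, ρ, hρ, hc⟩ := hv.exists_multipliers
    have hv' : v = c - ∑ j : I, ρ j • a j := by
      rw [Finset.sum_coe_sort I fun i => ρ i • a i, ← hc, sub_sub_cancel]
    have := (hΛ ⟨I, hI⟩ b c fun j => ρ j).1 fun i => by rw [← hv']; exact hact i i.2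
    refine ⟨⟨I, hI⟩, fun j => ?_, ?_⟩
    · rw [← this]
      exact hρ j j.2
    · rw [hX, ← this]
      exact hv'
  obtain ⟨K, hK⟩ : ∃ K : ℝ, ∀ I, ‖X I‖ ≤ K := (Set.finite_range fun I => ‖X I‖).bddAbove.imp
    fun K hK I => hK ⟨I, rfl⟩
  have hK0 : 0 ≤ K := (norm_nonneg (X ⟨∅, by simp⟩)).trans (hK _)
  refine ⟨K, hK0, fun b₁ b₂ c₁ c₂ v₁ v₂ h₁ h₂ => ?_⟩
  let γ : ℝ → (ι → ℝ) × E := AffineMap.lineMap (b₁, c₁) (b₂, c₂)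
  have hγ : Continuous γ := AffineMap.lineMap_continuous
  have hfeas : ∀ t ∈ Set.Icc (0 : ℝ) 1, ∃ v, IsPolyProj a (γ t).1 (γ t).2 v := by
    intro t ht
    refine exists_isPolyProj ⟨(1 - t) • v₁ + t • v₂, fun i => ?_⟩ _
    have e1 := mul_le_mul_of_nonneg_left (h₁.1 i) (sub_nonneg.2 ht.2)
    have e2 := mul_le_mul_of_nonneg_left (h₂.1 i) ht.1
    simp only [γ, AffineMap.lineMap_apply_module, inner_add_right, inner_smul_right]
    simp only [Prod.smul_mk, Prod.mk_add_mk, Pi.add_apply, Pi.smul_apply, smul_eq_mul]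
    linarith
  choose! f hf using hfeas
  -- `Z I` collects the parameters where the linear candidate `X I` has nonnegative multipliers and
  -- is feasible; by sufficiency of the KKT conditions it is the projection there.
  let Z : 𝓘 → Set ℝ := fun I => Set.Icc 0 1 ∩
    ({t | ∀ j, 0 ≤ Λ I (γ t) j} ∩ {t | ∀ i, inner ℝ (a i) (X I (γ t)) ≤ (γ t).1 i})
  have hZ : ∀ I, IsClosed (Z I) := by
    intro I
    refine isClosed_Icc.inter (IsClosed.inter ?_ ?_)
    · simp only [Set.ofPred_forall]
      have := (LinearMap.continuous_of_finiteDimensional (Λ I)).comp hγ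
      exact isClosed_iInter fun j => isClosed_le continuous_const
        ((continuous_apply j).comp this)
    · simp only [Set.ofPred_forall]
      exact isClosed_iInter fun i => isClosed_le
        (continuous_const.inner ((X I).continuous.comp hγ))
        ((continuous_apply i).comp hγ.fst)
  have hfZ : ∀ I, ∀ t ∈ Z I, f t = X I (γ t) := fun I t ht =>
    (hf t ht.1).unique (hproj I _ _ ht.2.1 ht.2.2)
  have hlip : ∀ I ∈ Finset.univ, ∀ s ∈ Z I, ∀ t ∈ Z I,
      ‖f s - f t‖ ≤ K * (‖b₁ - b₂‖ + ‖c₁ - c₂‖) * |s - t| := by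
    intro I _ s hs t ht
    rw [hfZ I s hs, hfZ I t ht, ← map_sub]
    have e : γ s - γ t = (s - t) • ((b₂, c₂) - (b₁, c₁)) := by
      simp only [γ, AffineMap.lineMap_apply_module']
      module
    have e' : ‖γ s - γ t‖ ≤ |s - t| * (‖b₁ - b₂‖ + ‖c₁ - c₂‖) := by
      rw [e, norm_smul, Real.norm_eq_abs]
      refine mul_le_mul_of_nonneg_left ?_ (abs_nonneg _)
      rw [Prod.mk_sub_mk, Prod.norm_mk, norm_sub_rev b₁, norm_sub_rev c₁]
      exact max_le_add_of_nonneg (norm_nonneg _) (norm_nonneg _)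
    calc ‖X I (γ s - γ t)‖ ≤ ‖X I‖ * ‖γ s - γ t‖ := (X I).le_opNorm _
      _ ≤ K * (|s - t| * (‖b₁ - b₂‖ + ‖c₁ - c₂‖)) := by
        gcongr
        exact hK I
      _ = _ := by ring
  have hcov : Set.Icc (0 : ℝ) 1 ⊆ ⋃ I ∈ (Finset.univ : Finset 𝓘), Z I := by
    intro t ht
    obtain ⟨I, hI, hI'⟩ := hex _ _ _ (hf t ht)
    simp only [Finset.mem_univ, Set.iUnion_true, Set.mem_iUnion]
    refine ⟨I, ht, hI, fun i => ?_⟩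
    rw [show X I (γ t) = f t from hI'.symm]
    exact (hf t ht).1 i
  have := norm_sub_le_of_finite_closed_cover hZ Finset.univ hlip 0 zero_le_one hcov
  have e0 : f 0 = v₁ := (hf 0 (by simp)).unique (by simpa [γ] using h₁)
  have e1 : f 1 = v₂ := (hf 1 (by simp)).unique (by simpa [γ] using h₂)
  simpa [e0, e1] using this

end Polyhedron

/-! ### Unit directions -/

section Directions

variable {E : Type*} [NormedAddCommGroup E] [InnerProductSpace ℝ E]

theorem norm_inv_norm_smul_le_one (x : E) : ‖‖x‖⁻¹ • x‖ ≤ 1 := by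
  rw [norm_smul, norm_inv, norm_norm]
  exact inv_mul_le_one

theorem norm_inv_norm_smul {x : E} (hx : 0 < ‖x‖) : ‖‖x‖⁻¹ • x‖ = 1 := by
  rw [norm_smul, norm_inv, norm_norm, inv_mul_cancel₀ hx.ne']

theorem norm_normalize_sub_normalize_le {m : ℝ} (hm : 0 < m) {x y : E} (hx : m ≤ ‖x‖)
    (hy : m ≤ ‖y‖) : ‖‖x‖⁻¹ • x - ‖y‖⁻¹ • y‖ ≤ 2 / m * ‖x - y‖ := by
  have hx0 : 0 < ‖x‖ := hm.trans_le hx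
  have hy0 : 0 < ‖y‖ := hm.trans_le hy
  have e : ‖x‖⁻¹ • x - ‖y‖⁻¹ • y = ‖x‖⁻¹ • ((x - y) + (‖y‖ - ‖x‖) • (‖y‖⁻¹ • y)) := by
    simp only [smul_add, smul_sub, smul_smul, sub_mul, sub_smul]
    rw [← mul_assoc, ← mul_assoc, inv_mul_cancel₀ hx0.ne', mul_assoc, mul_inv_cancel₀ hy0.ne',
      mul_one, one_mul]
    abel
  rw [e, norm_smul, norm_inv, norm_norm, inv_mul_le_iff₀ hx0]
  have h1 : ‖(‖y‖ - ‖x‖) • (‖y‖⁻¹ • y)‖ ≤ ‖x - y‖ := by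
    rw [norm_smul, norm_inv_norm_smul hy0, mul_one, Real.norm_eq_abs, norm_sub_rev]
    exact abs_norm_sub_norm_le y x
  calc ‖(x - y) + (‖y‖ - ‖x‖) • (‖y‖⁻¹ • y)‖ ≤ ‖x - y‖ + ‖x - y‖ :=
        (norm_add_le _ _).trans (add_le_add_right h1 _)
    _ = m * (2 / m * ‖x - y‖) := by field_simp; ring
    _ ≤ ‖x‖ * (2 / m * ‖x - y‖) := by gcongr

/-- Law of cosines: `2⟪x, y⟫ ≥ 2m² - d²`. Since this lower bound is nonnegative, the denominator
`‖x‖‖y‖` may be enlarged to `R²`. -/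
theorem norm_normalize_sub_normalize_sq_le {m R d : ℝ} (hm : 0 < m) (hd : d ^ 2 ≤ 2 * m ^ 2)
    {x y : E} (hx : m ≤ ‖x‖) (hy : m ≤ ‖y‖) (hxR : ‖x‖ ≤ R) (hyR : ‖y‖ ≤ R)
    (hxy : ‖x - y‖ ≤ d) :
    ‖‖x‖⁻¹ • x - ‖y‖⁻¹ • y‖ ^ 2 ≤ 2 - (2 * m ^ 2 - d ^ 2) / R ^ 2 := by
  have hx0 : 0 < ‖x‖ := hm.trans_le hx
  have hy0 : 0 < ‖y‖ := hm.trans_le hy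
  rw [norm_sub_sq_real, norm_inv_norm_smul hx0, norm_inv_norm_smul hy0, inner_smul_left,
    inner_smul_right]
  have h1 := norm_sub_sq_real x y
  have h2 : ‖x - y‖ ^ 2 ≤ d ^ 2 := pow_le_pow_left₀ (norm_nonneg _) hxy 2
  have h3 : m ^ 2 ≤ ‖x‖ ^ 2 := pow_le_pow_left₀ hm.le hx 2
  have h4 : m ^ 2 ≤ ‖y‖ ^ 2 := pow_le_pow_left₀ hm.le hy 2
  have h5 : (2 * m ^ 2 - d ^ 2) / R ^ 2 ≤ (2 * inner ℝ x y) / (‖x‖ * ‖y‖) := by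
    apply div_le_div₀ (by linarith) (by linarith) (by positivity)
    rw [sq]
    exact mul_le_mul hxR hyR hy0.le (hx0.le.trans hxR)
  have h6 : 2 * (‖x‖⁻¹ * (‖y‖⁻¹ * inner ℝ x y)) = (2 * inner ℝ x y) / (‖x‖ * ‖y‖) := by
    field_simp
  simp only [conj_trivial]
  linarith

end Directions

/-! ### Lipschitz dependence of distances and directions on the position -/

namespace Obstacles

variable {n N : ℕ} (O : Obstacles n N)

theorem norm_center_sub (i : Fin N) (q : Vec n) : ‖O.center i - q‖ = O.h i q + O.margin i := by
  rw [h, sub_add_cancel]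

theorem abs_h_sub_h_le (i : Fin N) (q₁ q₂ : Vec n) : |O.h i q₁ - O.h i q₂| ≤ ‖q₁ - q₂‖ := by
  have := abs_norm_sub_norm_le (O.center i - q₁) (O.center i - q₂)
  rw [sub_sub_sub_cancel_left, norm_sub_rev q₂] at this
  simpa [h] using this

theorem norm_dir_le_one (i : Fin N) (q : Vec n) : ‖O.dir i q‖ ≤ 1 := norm_inv_norm_smul_le_one _

theorem norm_dir {i : Fin N} {q : Vec n} (hq : 0 < ‖O.center i - q‖) : ‖O.dir i q‖ = 1 :=
  norm_inv_norm_smul hq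

theorem inner_dir_mem {l : Vec n} (hl : ‖l‖ = 1) (i : Fin N) (q : Vec n) :
    inner ℝ (O.dir i q) l ∈ Set.Icc (-1 : ℝ) 1 := by
  rw [Set.mem_Icc, ← abs_le]
  refine (abs_real_inner_le_norm _ _).trans ?_
  rw [hl, mul_one]
  exact O.norm_dir_le_one i q

variable [NeZero N]

theorem dmin_le (i : Fin N) : O.dmin ≤ O.margin i := Finset.inf'_le _ (Finset.mem_univ i)

theorem le_dmax (i : Fin N) : O.margin i ≤ O.dmax := Finset.le_sup' _ (Finset.mem_univ i)

theorem le_norm_center_sub {Δ : ℝ} {q : Vec n} {i : Fin N} (hq : -Δ ≤ O.h i q) :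
    O.dmin - Δ ≤ ‖O.center i - q‖ := by
  rw [norm_center_sub]
  linarith [O.dmin_le i]

theorem norm_dir_sub_dir_le {Δ : ℝ} (hΔ : Δ < O.dmin) {q₁ q₂ : Vec n} {i : Fin N}
    (h₁ : -Δ ≤ O.h i q₁) (h₂ : -Δ ≤ O.h i q₂) :
    ‖O.dir i q₁ - O.dir i q₂‖ ≤ 2 / (O.dmin - Δ) * ‖q₁ - q₂‖ := by
  have := norm_normalize_sub_normalize_le (sub_pos.2 hΔ) (O.le_norm_center_sub h₁)
    (O.le_norm_center_sub h₂)
  rwa [sub_sub_sub_cancel_left, norm_sub_rev q₂] at this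

end Obstacles

/-! ### The design constants -/

section Constants

variable {n N : ℕ} [NeZero N] {O : Obstacles n N} {da db dh dr vbar : ℝ}

theorem Obstacles.DistanceCondition.dmin_pos (hdist : O.DistanceCondition da db dh) :
    0 < O.dmin := hdist.da_pos.trans hdist.da_lt

theorem Obstacles.dmin_le_dmax : O.dmin ≤ O.dmax := (O.dmin_le 0).trans (O.le_dmax 0)

theorem Obstacles.DistanceCondition.four_mul_cstar (hdist : O.DistanceCondition da db dh) :
    4 * O.cstar da db = 2 - (2 * O.dmin ^ 2 - da ^ 2) / (O.dmax + db / 2) ^ 2 := by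
  have h1 := hdist.dmin_pos
  have h2 := O.dmin_le_dmax
  have h3 := hdist.db_pos
  have h4 : 0 < 2 * O.dmax + db := by linarith
  have h5 : O.dmax + db / 2 = (2 * O.dmax + db) / 2 := by ring
  rw [Obstacles.cstar, h5]
  field_simp
  ring

theorem Obstacles.DistanceCondition.cstar_pos (hdist : O.DistanceCondition da db dh) :
    0 < O.cstar da db := by
  have h1 := hdist.dmin_pos
  have h2 := O.dmin_le_dmax
  have h3 := hdist.db_pos
  have h4 : O.dmin ^ 2 ≤ O.dmax ^ 2 := pow_le_pow_left₀ h1.le h2 2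
  rw [Obstacles.cstar]
  have h5 : 0 < 2 * O.dmax + db := by linarith
  apply div_pos _ (by positivity)
  nlinarith [sq_nonneg da, sq_nonneg db]

theorem Obstacles.gap_pos (hdist : O.DistanceCondition da db dh) (hdr : 0 < dr)
    (hvbar : 2 * dr < vbar) : 0 < O.gap da db dr vbar := by
  have : 0 < dr / (vbar - dr) := div_pos hdr (by linarith)
  rw [Obstacles.gap, sub_pos]
  exact Real.sqrt_lt_sqrt hdist.cstar_pos.le (by linarith)

theorem Obstacles.gap_mul (hdist : O.DistanceCondition da db dh) (hdr : 0 < dr)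
    (hvbar : 2 * dr < vbar) : O.gap da db dr vbar *
      (√(O.cstar da db) + √(O.cstar da db + dr / (vbar - dr))) = dr / (vbar - dr) := by
  have h0 : 0 < dr / (vbar - dr) := div_pos hdr (by linarith)
  have h1 := Real.sq_sqrt hdist.cstar_pos.le
  have h2 := Real.sq_sqrt (add_pos hdist.cstar_pos h0).le
  rw [Obstacles.gap]
  linear_combination h2 - h1

/-- With `e = d_r / (v̄ - d_r)` the hypothesis reads `4c* < (1 - e)²`, that is `e < 1 - 2√c*`, which
is `c* + e < (1 - √c*)²`. This leaves room for a `c₀ < 1`. -/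
theorem Obstacles.sqrt_cstar_add_sqrt_lt_one (hdist : O.DistanceCondition da db dh) (hdr : 0 < dr)
    (hvbar : 2 * dr < vbar)
    (hcond : 1 - (vbar - 2 * dr) ^ 2 / (2 * (vbar - dr) ^ 2)
      < (2 * O.dmin ^ 2 - da ^ 2) / (2 * (O.dmax + db / 2) ^ 2)) :
    √(O.cstar da db) + √(O.cstar da db + dr / (vbar - dr)) < 1 := by
  have hv : 0 < vbar - dr := by linarith
  set e := dr / (vbar - dr) with he
  have h1 : (vbar - 2 * dr) ^ 2 / (2 * (vbar - dr) ^ 2) = (1 - e) ^ 2 / 2 := by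
    rw [he]
    field_simp
    ring
  have he1 : e < 1 := by
    rw [he, div_lt_one hv]
    linarith
  have h2 : (2 * O.dmin ^ 2 - da ^ 2) / (2 * (O.dmax + db / 2) ^ 2)
      = (2 - 4 * O.cstar da db) / 2 := by
    rw [hdist.four_mul_cstar, sub_sub_cancel, div_div, mul_comm ((O.dmax + db / 2) ^ 2) 2]
  rw [h1, h2] at hcond
  have h3 : √(O.cstar da db) < (1 - e) / 2 := by
    rw [Real.sqrt_lt' (by linarith)]
    linarith
  have h4 : √(O.cstar da db + e) < 1 - √(O.cstar da db) := by
    have he0 : 0 < e := div_pos hdr hv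
    rw [Real.sqrt_lt' (by linarith)]
    have := Real.sq_sqrt hdist.cstar_pos.le
    nlinarith
  linarith

/-- For small constraint violations, the directions to nearby obstacles are close to each other. -/
theorem Obstacles.exists_norm_dir_sub_le (hdist : O.DistanceCondition da db dh) {c₀ : ℝ}
    (hc₀ : √(O.cstar da db) + √(O.cstar da db + dr / (vbar - dr)) < c₀) :
    ∃ Δ : ℝ, 0 < Δ ∧ Δ ≤ dh ∧ ∀ q : Vec n, (∀ i, -Δ ≤ O.h i q) → ∀ j k,
      O.h j q ≤ db / 2 → O.h k q ≤ db / 2 →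
        ‖O.dir j q - O.dir k q‖ ≤ c₀ - O.gap da db dr vbar := by
  have hgap : 2 * √(O.cstar da db) < c₀ - O.gap da db dr vbar := by
    rw [Obstacles.gap]
    linarith
  have hpos : 0 ≤ c₀ - O.gap da db dr vbar := (by positivity : (0:ℝ) ≤ _).trans hgap.le
  -- The squared direction bound at `Δ = 0` is `4c*`, strictly below `(c₀ - κ)²`; continuity in `Δ`
  -- supplies a positive violation.
  have h0 : 2 - (2 * (O.dmin - 0) ^ 2 - da ^ 2) / (O.dmax + db / 2) ^ 2
      < (c₀ - O.gap da db dr vbar) ^ 2 := by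
    rw [sub_zero, ← hdist.four_mul_cstar]
    have := Real.sq_sqrt hdist.cstar_pos.le
    nlinarith [Real.sqrt_nonneg (O.cstar da db)]
  have h1 : ContinuousAt (fun Δ : ℝ =>
      2 - (2 * (O.dmin - Δ) ^ 2 - da ^ 2) / (O.dmax + db / 2) ^ 2) 0 := by fun_prop
  have h2 : ContinuousAt (fun Δ : ℝ => 2 * (O.dmin - Δ) ^ 2) 0 := by fun_prop
  have hev := (h1.eventually_lt_const h0).and (h2.eventually_const_lt (u := da ^ 2) (by
    have := hdist.da_pos
    have := hdist.da_lt
    dsimp only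
    rw [sub_zero]
    nlinarith))
  obtain ⟨Δ, ⟨hΔ1, hΔ2⟩, hΔ0, hΔh⟩ := ((hev.filter_mono nhdsWithin_le_nhds).and
    (Ioc_mem_nhdsGT hdist.dh_pos)).exists
  refine ⟨Δ, hΔ0, hΔh, fun q hq j k hj hk => ?_⟩
  have hclose := hdist.close q (fun i => (neg_le_neg hΔh).trans (hq i)) j k hj hk
  have hR : ∀ i, O.h i q ≤ db / 2 → ‖O.center i - q‖ ≤ O.dmax + db / 2 := by
    intro i hi
    rw [Obstacles.norm_center_sub]
    linarith [O.le_dmax i]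
  have := norm_normalize_sub_normalize_sq_le (sub_pos.2 (hΔh.trans_lt hdist.dh_lt)) hΔ2.le
    (O.le_norm_center_sub (hq j)) (O.le_norm_center_sub (hq k)) (hR j hj) (hR k hk)
    (by rwa [sub_sub_sub_cancel_right])
  exact (pow_le_pow_iff_left₀ (norm_nonneg _) hpos two_ne_zero).1 (this.trans hΔ1.le)

end Constants

/-! ### Feasibility, bounds and regularity of the reduced quadratic program -/

namespace Design

variable {n N : ℕ} {D : Design n} {O : Obstacles n N} {da db dh dr vbar : ℝ}

section Basic

variable [NeZero N]

theorem Admissible.αinv_le_iff (hD : D.Admissible O da db dh dr vbar) {x y : ℝ} :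
    D.αinv y ≤ x ↔ y ≤ D.α x := by
  rw [← hD.α_classKe.strictMono.le_iff_le, hD.αinv_right y]

theorem Admissible.αinv_lt_iff (hD : D.Admissible O da db dh dr vbar) {x y : ℝ} :
    D.αinv y < x ↔ y < D.α x := by
  rw [← hD.α_classKe.strictMono.lt_iff_lt, hD.αinv_right y]

theorem Admissible.le_αinv_iff (hD : D.Admissible O da db dh dr vbar) {x y : ℝ} :
    x ≤ D.αinv y ↔ D.α x ≤ y := by
  rw [← hD.α_classKe.strictMono.le_iff_le, hD.αinv_right y]

/-- An obstacle outside `nearby` has `h i > d_f` and `φ ≥ 0`, so including it does not change the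
minimum capped at `d_f`. Thus `r` is a minimum over a fixed index set, with no jump when `nearby`
changes. -/
theorem Admissible.le_r_iff (hD : D.Admissible O da db dh dr vbar) {q l : Vec n} (hl : ‖l‖ = 1)
    {x : ℝ} : x ≤ D.r O q l ↔ x ≤ D.df ∧ ∀ i, x ≤ O.h i q + D.φ (inner ℝ (O.dir i q) l) := by
  classical
  have hmem : ∀ i, i ∈ O.nearby D.df q ↔ O.h i q ≤ D.df := by
    intro i
    simp [Obstacles.nearby]
  have hfar : ∀ i, i ∉ O.nearby D.df q → D.df ≤ O.h i q + D.φ (inner ℝ (O.dir i q) l) := by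
    intro i hi
    rw [hmem, not_le] at hi
    linarith [hD.φ_nonneg _ (O.inner_dir_mem hl i q)]
  rw [r]
  split_ifs with hJ
  · rw [le_min_iff, Finset.le_inf'_iff, and_comm]
    refine and_congr_right fun hx => ⟨fun h i => ?_, fun h i _ => h i⟩
    by_cases hi : i ∈ O.nearby D.df q
    exacts [h i hi, hx.trans (hfar i hi)]
  · exact ⟨fun hx => ⟨hx, fun i => hx.trans (hfar i fun hi => hJ ⟨i, hi⟩)⟩, fun h => h.1⟩

theorem Admissible.r_le_df (hD : D.Admissible O da db dh dr vbar) {q l : Vec n} (hl : ‖l‖ = 1) :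
    D.r O q l ≤ D.df := ((hD.le_r_iff hl).1 le_rfl).1

theorem Admissible.le_constraint_iff (hD : D.Admissible O da db dh dr vbar) {q l : Vec n}
    (hl : ‖l‖ = 1) {x : ℝ} : x ≤ D.c₀ * D.α (D.r O q l) - dr ↔
      x ≤ D.c₀ * D.α D.df - dr ∧
        ∀ i, x ≤ D.c₀ * D.α (O.h i q + D.φ (inner ℝ (O.dir i q) l)) - dr := by
  have key : ∀ y, x ≤ D.c₀ * D.α y - dr ↔ D.αinv ((x + dr) / D.c₀) ≤ y := by
    intro y
    rw [hD.αinv_le_iff, div_le_iff₀' hD.c₀_pos, le_sub_iff_add_le]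
  simp only [key]
  exact hD.le_r_iff hl

theorem Admissible.α_nonneg (hD : D.Admissible O da db dh dr vbar) {x : ℝ} (hx : 0 ≤ x) :
    0 ≤ D.α x := by
  rw [← hD.α_classKe.map_zero]
  exact hD.α_classKe.strictMono.monotone hx

theorem Admissible.α_nonpos (hD : D.Admissible O da db dh dr vbar) {x : ℝ} (hx : x ≤ 0) :
    D.α x ≤ 0 := by
  rw [← hD.α_classKe.map_zero]
  exact hD.α_classKe.strictMono.monotone hx

/-- The reduced quadratic program is feasible near the safe set. -/
theorem Admissible.feasible_nonempty (hD : D.Admissible O da db dh dr vbar)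
    (hgap : 0 < O.gap da db dr vbar) (hdr : 0 < dr) {Δ : ℝ} (hΔ : Δ ∈ Set.Icc 0 dh) {q : Vec n}
    (hq : ∀ i, -Δ ≤ O.h i q) (hpos : ∀ i, 0 < ‖O.center i - q‖)
    (hdir : ∀ j k, O.h j q ≤ db / 2 → O.h k q ≤ db / 2 →
      ‖O.dir j q - O.dir k q‖ ≤ D.c₀ - O.gap da db dr vbar) :
    (D.feasible O dr q).Nonempty := by
  set κ := O.gap da db dr vbar with hκ
  have hc := hD.c₀_pos
  have hmono := hD.α_classKe.strictMono.monotone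
  obtain ⟨K, hKdef⟩ : ∃ K, K = (dr - D.c₀ * D.α (-Δ)) / κ := ⟨_, rfl⟩
  have hKκ : K * κ = dr - D.c₀ * D.α (-Δ) := by rw [hKdef, div_mul_cancel₀ _ hgap.ne']
  have hα : D.c₀ * D.α (-Δ) ≤ 0 :=
    mul_nonpos_of_nonneg_of_nonpos hc.le (hD.α_nonpos (by linarith [hΔ.1]))
  have hK0 : 0 ≤ K := by
    rw [hKdef]
    exact div_nonneg (by linarith) hgap.le
  have hαdh : D.c₀ * D.α (-dh) ≤ D.c₀ * D.α (-Δ) :=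
    mul_le_mul_of_nonneg_left (hmono (neg_le_neg hΔ.2)) hc.le
  have hKle : K ≤ (dr - D.c₀ * D.α (-dh)) / κ := by
    rw [hKdef]
    gcongr
  have hKdb : K ≤ D.c₀ * D.α (db / 2) - dr := hKle.trans hD.α_lower.le
  have hKdf : K ≤ D.c₀ * D.α D.df - dr := by
    have h1 := hD.αinv_lt_iff.1 hD.df_lower
    rw [← hκ, div_lt_iff₀ (mul_pos hc hgap)] at h1
    rw [hKdef, div_le_iff₀ hgap]
    nlinarith
  -- Speed at most `K` already meets the cap from `d_f` and all constraints from obstacles farther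
  -- than `d_b / 2`.
  have hred : ∀ v : Vec n, ‖v‖ ≤ K → (∀ l ∈ D.basis, ∀ i, O.h i q ≤ db / 2 →
      inner ℝ l v ≤ D.c₀ * D.α (O.h i q + D.φ (inner ℝ (O.dir i q) l)) - dr) →
      (D.feasible O dr q).Nonempty := by
    refine fun v hv h => ⟨v, fun l hl => ?_⟩
    have hl1 := hD.basis.1 l hl
    have hvK : inner ℝ l v ≤ K := by
      refine (real_inner_le_norm _ _).trans ?_
      rwa [hl1, one_mul]
    refine (hD.le_constraint_iff hl1).2 ⟨hvK.trans hKdf, fun i => ?_⟩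
    rcases le_or_gt (O.h i q) (db / 2) with hi | hi
    · exact h l hl i hi
    · refine (hvK.trans hKdb).trans ?_
      have := hmono (show db / 2 ≤ O.h i q + D.φ (inner ℝ (O.dir i q) l) by
        linarith [hD.φ_nonneg _ (O.inner_dir_mem hl1 i q)])
      have := mul_le_mul_of_nonneg_left this hc.le
      linarith
  by_cases hk : ∃ k, O.h k q ≤ db / 2
  · obtain ⟨k, hk⟩ := hk
    refine hred (-K • O.dir k q) ?_ fun l hl i hi => ?_
    · rw [norm_smul, O.norm_dir (hpos k), mul_one, Real.norm_eq_abs, abs_neg, abs_of_nonneg hK0]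
    have hl1 := hD.basis.1 l hl
    have hs := O.inner_dir_mem hl1 i q
    have h1 : inner ℝ l (-K • O.dir k q) ≤ -K * inner ℝ (O.dir i q) l + K * (D.c₀ - κ) := by
      have h2 : inner ℝ (O.dir i q - O.dir k q) l ≤ D.c₀ - κ := by
        refine (real_inner_le_norm _ _).trans ?_
        rw [hl1, mul_one]
        exact hdir i k hi hk
      rw [inner_sub_left] at h2
      rw [inner_smul_right, real_inner_comm]
      nlinarith
    refine h1.trans ?_
    set s : ℝ := inner ℝ (O.dir i q) l with hsdef
    -- Below `c₀`, the requirement on `φ` with `p = Δ` is exactly the needed inequality. From `c₀`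
    -- on, `-K(s - c₀) ≤ 0` and the choice of `K` suffices.
    rcases lt_or_ge s D.c₀ with hsc | hsc
    · have h3 := hD.φ_large s ⟨hs.1, hsc⟩ Δ hΔ K (by rw [hKdef]; simp [hκ])
      rw [← lt_sub_iff_add_lt, hD.αinv_lt_iff, ← add_div, div_lt_iff₀ hc, ← hκ] at h3
      have h4 := mul_le_mul_of_nonneg_left (hmono (show D.φ s - Δ ≤ O.h i q + D.φ s by
        linarith [hq i])) hc.le
      linarith
    · have h4 := mul_le_mul_of_nonneg_left (hmono (show -Δ ≤ O.h i q + D.φ s by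
        linarith [hq i, hD.φ_nonneg s hs])) hc.le
      nlinarith
  · push Not at hk
    exact hred 0 (by simpa using hK0) fun l _ i hi => absurd hi (not_le.2 (hk i))

end Basic

/-- The right-hand side of the constraints of the reduced quadratic program. -/
def bound (D : Design n) (O : Obstacles n N) (dr : ℝ) (q : Vec n) (l : D.basis) : ℝ :=
  D.c₀ * D.α (D.r O q l) - dr

theorem mem_feasible_iff {q v : Vec n} : v ∈ D.feasible O dr q ↔
    ∀ l : D.basis, inner ℝ (l : Vec n) v ≤ D.bound O dr q l :=
  ⟨fun h l => h l l.2, fun h l hl => h ⟨l, hl⟩⟩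

/-- Passes from minimality to the variational inequality, for which the projection results are
stated. -/
theorem isQPSolution_iff {q vc v : Vec n} : D.IsQPSolution O dr q vc v ↔
    IsPolyProj (fun l : D.basis => (l : Vec n)) (D.bound O dr q) vc v := by
  have key : ∀ {p : Vec n},
      IsPolyProj (fun l : D.basis => (l : Vec n)) (D.bound O dr q) vc p →
      ∀ w ∈ D.feasible O dr q, ‖w - p‖ ^ 2 + ‖p - vc‖ ^ 2 ≤ ‖w - vc‖ ^ 2 := by
    intro p hp w hw
    have h1 := hp.2 w (mem_feasible_iff.1 hw)
    have h2 : w - vc = (w - p) - (vc - p) := by abel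
    rw [h2, norm_sub_sq_real (w - p), real_inner_comm, norm_sub_rev p vc]
    linarith
  constructor
  · intro h
    obtain ⟨p, hp⟩ := exists_isPolyProj ⟨v, mem_feasible_iff.1 h.1⟩ vc
    have h1 := key hp v h.1
    have h2 := h.2 p (mem_feasible_iff.2 hp.1)
    have h3 : ‖v - p‖ = 0 := by
      have := sq_nonneg ‖v - p‖
      exact pow_eq_zero_iff two_ne_zero |>.1 (le_antisymm (by linarith) this)
    rwa [sub_eq_zero.1 (norm_eq_zero.1 h3)]
  · intro h
    refine ⟨mem_feasible_iff.2 h.1, fun w hw => ?_⟩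
    linarith [key h w hw, sq_nonneg ‖w - v‖]

theorem existsUnique_isQPSolution {q : Vec n} (hq : (D.feasible O dr q).Nonempty) (vc : Vec n) :
    ∃! v, D.IsQPSolution O dr q vc v := by
  obtain ⟨v, hv⟩ := hq
  obtain ⟨p, hp⟩ := exists_isPolyProj ⟨v, mem_feasible_iff.1 hv⟩ vc
  exact ⟨p, isQPSolution_iff.2 hp, fun w hw => (isQPSolution_iff.1 hw).unique hp⟩

theorem isQPSolution_outer {q : Vec n} (hq : (D.feasible O dr q).Nonempty) (vc : Vec n) :
    D.IsQPSolution O dr q vc (D.outer O dr q vc) := by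
  have hv := (existsUnique_isQPSolution hq vc).exists
  rw [outer, dif_pos hv]
  exact hv.choose_spec

variable [NeZero N]

/-- Some basis vector `l` makes inner product at least `c₀` with the direction of `v`, so `c₀‖v‖` is
bounded by the cap `c₀ α(d_f) - d_r ≤ c₀(v̄ - d_r)`. -/
theorem Admissible.norm_le_of_mem_feasible (hD : D.Admissible O da db dh dr vbar) {q v : Vec n}
    (hv : v ∈ D.feasible O dr q) (h0 : 0 ≤ vbar - dr) : ‖v‖ ≤ vbar - dr := by
  rcases (norm_nonneg v).eq_or_lt with h | h
  · rwa [← h]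
  have hu := norm_inv_norm_smul h
  obtain ⟨-, ρ, -, hρ, hsum⟩ := hD.basis.2 _ hu
  obtain ⟨l, hl, hl0⟩ : ∃ l ∈ D.basis, ρ l ≠ 0 := by
    by_contra! hcon
    rw [hsum, Finset.sum_eq_zero fun l hl => by rw [hcon l hl, zero_smul]] at hu
    simp at hu
  have h1 := hρ l hl hl0
  rw [inner_smul_right, ← div_eq_inv_mul, le_div_iff₀ h] at h1
  have h2 := ((hD.le_constraint_iff (hD.basis.1 l hl)).1 (hv l hl)).1
  have h3 := mul_le_mul_of_nonneg_left (hD.le_αinv_iff.1 hD.df_upper) hD.c₀_pos.le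
  have h4 : D.c₀ * (vbar + (1 / D.c₀ - 1) * dr) = D.c₀ * (vbar - dr) + dr := by
    have := hD.c₀_pos.ne'
    field_simp
    ring
  refine le_of_mul_le_mul_left (a := D.c₀) ?_ hD.c₀_pos
  linarith

/-- Feasible velocities respect the barrier constraint along the direction to each obstacle. -/
theorem Admissible.inner_dir_le (hD : D.Admissible O da db dh dr vbar) {q v : Vec n}
    (hv : v ∈ D.feasible O dr q) {i : Fin N} (hi : 0 < ‖O.center i - q‖) :
    inner ℝ (O.dir i q) v ≤
      max (D.c₀ * D.α (O.h i q) - dr) ((D.c₀ * D.α (O.h i q) - dr) / D.c₀) := by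
  have hc := hD.c₀_pos
  have hu := O.norm_dir hi
  obtain ⟨-, ρ, hρ0, hρ, hsum⟩ := hD.basis.2 _ hu
  have hle : ∀ l ∈ D.basis, ρ l * inner ℝ l v ≤ ρ l * (D.c₀ * D.α (O.h i q) - dr) := by
    intro l hl
    rcases eq_or_ne (ρ l) 0 with h0 | h0
    · simp [h0]
    refine mul_le_mul_of_nonneg_left ?_ (hρ0 l hl)
    have h1 := hρ l hl h0
    have hl1 := hD.basis.1 l hl
    have h2 := ((hD.le_constraint_iff hl1).1 (hv l hl)).2 i
    rwa [hD.φ_zero, add_zero] at h2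
    rw [real_inner_comm]
    refine ⟨h1, ?_⟩
    rw [real_inner_comm]
    exact (O.inner_dir_mem hl1 i q).2
  have h1 : inner ℝ (O.dir i q) v = ∑ l ∈ D.basis, ρ l * inner ℝ l v := by
    conv_lhs => rw [hsum]
    rw [sum_inner]
    exact Finset.sum_congr rfl fun l _ => by rw [inner_smul_left, conj_trivial]
  have h2 : inner ℝ (O.dir i q) v ≤ (∑ l ∈ D.basis, ρ l) * (D.c₀ * D.α (O.h i q) - dr) := by
    rw [h1, Finset.sum_mul]
    exact Finset.sum_le_sum hle
  -- The weights sum to between `1` (triangle inequality) and `1 / c₀` (pairing with the direction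
  -- itself). Which end is extremal depends on the sign of the barrier term, hence the maximum in
  -- the statement.
  have h3 : 1 ≤ ∑ l ∈ D.basis, ρ l := by
    rw [← hu]
    conv_lhs => rw [hsum]
    refine (norm_sum_le _ _).trans (Finset.sum_le_sum fun l hl => ?_)
    rw [norm_smul, hD.basis.1 l hl, mul_one, Real.norm_eq_abs, abs_of_nonneg (hρ0 l hl)]
  have h4 : (∑ l ∈ D.basis, ρ l) * D.c₀ ≤ 1 := by
    have : (1 : ℝ) = ∑ l ∈ D.basis, ρ l * inner ℝ l (O.dir i q) := by
      have e : (1 : ℝ) = inner ℝ (O.dir i q) (O.dir i q) := by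
        rw [real_inner_self_eq_norm_sq, hu, one_pow]
      rw [e]
      conv_lhs => enter [2]; rw [hsum]
      rw [sum_inner]
      exact Finset.sum_congr rfl fun l _ => by rw [inner_smul_left, conj_trivial]
    rw [this, Finset.sum_mul]
    refine Finset.sum_le_sum fun l hl => ?_
    rcases eq_or_ne (ρ l) 0 with h0 | h0
    · simp [h0]
    · exact mul_le_mul_of_nonneg_left (hρ l hl h0) (hρ0 l hl)
  rcases le_total (D.c₀ * D.α (O.h i q) - dr) 0 with hs | hs
  · refine le_max_of_le_left (h2.trans ?_)
    nlinarith
  · refine le_max_of_le_right (h2.trans ?_)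
    rw [le_div_iff₀ hc]
    nlinarith

theorem Admissible.exists_bound_lipschitz (hD : D.Admissible O da db dh dr vbar) {Δ : ℝ}
    (hΔ : Δ < O.dmin) : ∃ K : ℝ, 0 ≤ K ∧ ∀ q₁ q₂ : Vec n,
      (∀ i, -Δ ≤ O.h i q₁) → (∀ i, -Δ ≤ O.h i q₂) →
        ‖D.bound O dr q₁ - D.bound O dr q₂‖ ≤ K * ‖q₁ - q₂‖ := by
  obtain ⟨Kφ, hφ⟩ := hD.φ_lipschitz
  obtain ⟨Kα, hα⟩ := hD.α_lipschitz
  have hm : 0 < O.dmin - Δ := sub_pos.2 hΔ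
  -- A one-sided estimate through `le_r_iff` suffices, the other side following by exchanging `q₁`
  -- and `q₂`.
  have hr : ∀ q₁ q₂ : Vec n, (∀ i, -Δ ≤ O.h i q₁) → (∀ i, -Δ ≤ O.h i q₂) →
      ∀ l : Vec n, ‖l‖ = 1 →
        D.r O q₁ l - (1 + Kφ * (2 / (O.dmin - Δ))) * ‖q₁ - q₂‖ ≤ D.r O q₂ l := by
    intro q₁ q₂ h₁ h₂ l hl
    rw [hD.le_r_iff hl]
    have h0 : 0 ≤ (1 + Kφ * (2 / (O.dmin - Δ))) * ‖q₁ - q₂‖ := by positivity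
    refine ⟨by linarith [hD.r_le_df (O := O) (q := q₁) hl], fun i => ?_⟩
    have e1 := ((hD.le_r_iff (O := O) (q := q₁) hl).1 le_rfl).2 i
    have e2 := (abs_le.1 (O.abs_h_sub_h_le i q₁ q₂)).2
    have e3 := hφ.norm_sub_le (O.inner_dir_mem hl i q₁) (O.inner_dir_mem hl i q₂)
    have e4 : ‖(inner ℝ (O.dir i q₁) l - inner ℝ (O.dir i q₂) l : ℝ)‖
        ≤ 2 / (O.dmin - Δ) * ‖q₁ - q₂‖ := by
      rw [← inner_sub_left]
      refine (norm_inner_le_norm _ _).trans ?_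
      rw [hl, mul_one]
      exact O.norm_dir_sub_dir_le hΔ (h₁ i) (h₂ i)
    have e5 := (le_abs_self _).trans (e3.trans (mul_le_mul_of_nonneg_left e4 Kφ.2))
    nlinarith
  refine ⟨D.c₀ * (Kα * (1 + Kφ * (2 / (O.dmin - Δ)))), by
    have := hD.c₀_pos
    positivity, fun q₁ q₂ h₁ h₂ => ?_⟩
  have hc := hD.c₀_pos
  refine (pi_norm_le_iff_of_nonneg (by positivity)).2 fun l => ?_
  have hl := hD.basis.1 l l.2
  have f1 : |D.r O q₁ l - D.r O q₂ l| ≤ (1 + Kφ * (2 / (O.dmin - Δ))) * ‖q₁ - q₂‖ := by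
    have g1 := hr q₁ q₂ h₁ h₂ l hl
    have g2 := hr q₂ q₁ h₂ h₁ l hl
    rw [norm_sub_rev] at g2
    rw [abs_le]
    constructor <;> linarith
  have f2 := hα.norm_sub_le (D.r O q₁ l) (D.r O q₂ l)
  rw [Real.norm_eq_abs, Real.norm_eq_abs] at f2
  have f3 : (D.bound O dr q₁ - D.bound O dr q₂) l
      = D.c₀ * (D.α (D.r O q₁ l) - D.α (D.r O q₂ l)) := by
    simp only [Pi.sub_apply, bound]
    ring
  rw [f3, Real.norm_eq_abs, abs_mul, abs_of_pos hc, mul_assoc, mul_assoc]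
  gcongr
  exact f2.trans (by gcongr)

theorem Admissible.exists_outerLipschitz (hD : D.Admissible O da db dh dr vbar) {Δ : ℝ}
    (hΔ : Δ < O.dmin) (hfeas : ∀ q, (∀ i, -Δ ≤ O.h i q) → (D.feasible O dr q).Nonempty) :
    ∃ L : ℝ, 0 < L ∧ D.OuterLipschitz O dr Δ L := by
  obtain ⟨K, hK, hKl⟩ := hD.exists_bound_lipschitz (dr := dr) hΔ
  obtain ⟨P, hP, hPl⟩ := exists_isPolyProj_lipschitz fun l : D.basis => (l : Vec n)
  refine ⟨P * (K + 1) + 1, by positivity, fun q₁ q₂ hq v₁ v₂ => ?_⟩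
  have hq₁ := fun i => (le_min_iff.1 (hq i)).1
  have hq₂ := fun i => (le_min_iff.1 (hq i)).2
  have h1 := hPl _ _ _ _ _ _ (isQPSolution_iff.1 (isQPSolution_outer (hfeas q₁ hq₁) v₁))
    (isQPSolution_iff.1 (isQPSolution_outer (hfeas q₂ hq₂) v₂))
  refine h1.trans ?_
  have h2 := hKl q₁ q₂ hq₁ hq₂
  have h3 : ‖D.bound O dr q₁ - D.bound O dr q₂‖ + ‖v₁ - v₂‖
      ≤ (K + 1) * (‖q₁ - q₂‖ + ‖v₁ - v₂‖) := by
    nlinarith [norm_nonneg (q₁ - q₂), norm_nonneg (v₁ - v₂)]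
  have h4 := mul_le_mul_of_nonneg_left h3 hP
  nlinarith [norm_nonneg (q₁ - q₂), norm_nonneg (v₁ - v₂)]

end Design

/-! ### Existence of admissible design parameters -/

section PosBasis

variable {n : ℕ}

/-- Take the vertices of a small simplex around `u` and normalize them: rescaling generators does
not change the cone. -/
theorem exists_finset_conicSpan_mem_nhds [NeZero n] {c : ℝ} (hc : c < 1) {u : Vec n} (hu : ‖u‖ = 1) :
    ∃ B : Finset (Vec n), (∀ l ∈ B, ‖l‖ = 1 ∧ c < inner ℝ l u) ∧ conicSpan id B ∈ 𝓝 u := by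
  classical
  have hu0 : u ≠ 0 := by
    rintro rfl
    simp at hu
  have hcont : ContinuousAt (fun y : Vec n => (inner ℝ (‖y‖⁻¹ • y) u : ℝ)) u :=
    ((continuousAt_id.norm.inv₀ (norm_ne_zero_iff.2 hu0)).smul continuousAt_id).inner
      continuousAt_const
  have hs : {y : Vec n | y ≠ 0 ∧ c < inner ℝ (‖y‖⁻¹ • y) u} ∈ 𝓝 u := by
    refine (eventually_ne_nhds hu0).and (hcont.eventually_const_lt ?_)
    simpa [hu] using hc
  obtain ⟨b, hb, hbs⟩ := exists_mem_interior_convexHull_affineBasis hs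
  have hbs' := fun i => hbs (subset_convexHull ℝ _ ⟨i, rfl⟩)
  refine ⟨Finset.univ.image fun i => ‖b i‖⁻¹ • b i, fun l hl => ?_, ?_⟩
  · obtain ⟨i, -, rfl⟩ := Finset.mem_image.1 hl
    exact ⟨norm_inv_norm_smul (norm_pos_iff.2 (hbs' i).1), (hbs' i).2⟩
  · refine mem_of_superset (mem_interior_iff_mem_nhds.1 hb) (convexHull_min ?_ (convex_conicSpan _ _))
    rintro _ ⟨i, rfl⟩
    have hi := norm_ne_zero_iff.2 (hbs' i).1
    refine ⟨Pi.single (‖b i‖⁻¹ • b i) ‖b i‖, fun l _ => ?_, ?_⟩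
    · rcases eq_or_ne l (‖b i‖⁻¹ • b i) with rfl | h
      · simp
      · simp [h]
    · rw [Finset.sum_eq_single (‖b i‖⁻¹ • b i)]
      · rw [Pi.single_eq_same, id, smul_smul, mul_inv_cancel₀ hi, one_smul]
      · intro l _ h
        simp [h]
      · intro h
        exact absurd (Finset.mem_image_of_mem _ (Finset.mem_univ i)) h

/-- A cone with nonempty interior spans the space. -/
theorem card_le_of_conicSpan_mem_nhds {B : Finset (Vec n)} {u : Vec n}
    (h : conicSpan id B ∈ 𝓝 u) : n ≤ B.card := by
  have hspan : Submodule.span ℝ (B : Set (Vec n)) = ⊤ := by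
    refine Submodule.eq_top_of_nonempty_interior' _ ⟨u, ?_⟩
    refine interior_mono ?_ (mem_interior_iff_mem_nhds.2 h)
    rintro x ⟨ρ, -, rfl⟩
    exact Submodule.sum_mem _ fun l hl =>
      Submodule.smul_mem _ _ (Submodule.subset_span (Finset.mem_coe.2 hl))
  have := finrank_span_finset_le_card (R := ℝ) B
  rw [Set.finrank, hspan, finrank_top] at this
  simpa using this

/-- A positive basis exists for every constant below `1`. -/
theorem exists_isPosBasis [NeZero n] {c : ℝ} (hc : c < 1) : ∃ B : Finset (Vec n), IsPosBasis c B := by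
  classical
  choose! B hB hB' using fun (u : Vec n) (hu : ‖u‖ = 1) => exists_finset_conicSpan_mem_nhds hc hu
  -- Both properties of the local generators persist for directions near `u`, so finitely many local
  -- sets serve the whole sphere.
  have hU : ∀ u ∈ Metric.sphere (0 : Vec n) 1,
      {v | conicSpan id (B u) ∈ 𝓝 v ∧ ∀ l ∈ B u, c < inner ℝ l v} ∈ 𝓝 u := by
    intro u hu
    rw [mem_sphere_zero_iff_norm] at hu
    refine Filter.Eventually.and (eventually_eventually_nhds.2 (hB' u hu))
      ((eventually_all_finset _).2 ?_)
    intro l hl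
    have : Continuous fun v : Vec n => (inner ℝ l v : ℝ) := by fun_prop
    exact this.continuousAt.eventually_const_lt (hB u hu l hl).2
  obtain ⟨T, hT, hcov⟩ := (isCompact_sphere (0 : Vec n) 1).elim_nhds_subcover _ hU
  refine ⟨T.biUnion B, fun l hl => ?_, fun u hu => ?_⟩
  · obtain ⟨t, ht, hl⟩ := Finset.mem_biUnion.1 hl
    exact (hB t (mem_sphere_zero_iff_norm.1 (hT t ht)) l hl).1
  · obtain ⟨t, ht, hut, hlt⟩ : ∃ t ∈ T, conicSpan id (B t) ∈ 𝓝 u ∧ ∀ l ∈ B t, c < inner ℝ l u := by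
      simpa only [Set.mem_iUnion, exists_prop, Set.mem_ofPred_eq] using hcov (mem_sphere_zero_iff_norm.2 hu)
    have hsub : B t ⊆ T.biUnion B := Finset.subset_biUnion_of_mem B ht
    constructor
    · have hfin : {l : Vec n | l ∈ T.biUnion B ∧ c ≤ inner ℝ l u}.Finite :=
        (T.biUnion B).finite_toSet.subset fun l hl => hl.1
      refine (card_le_of_conicSpan_mem_nhds hut).trans ?_
      rw [← Set.ncard_coe_finset]
      exact Set.ncard_le_ncard (fun l hl => ⟨hsub hl, (hlt l hl).le⟩) hfin
    · obtain ⟨ρ, hρ, hsum⟩ := mem_of_mem_nhds hut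
      refine ⟨fun l => if l ∈ B t then ρ l else 0, fun l _ => ?_, fun l _ hl => ?_, ?_⟩
      · dsimp only
        split_ifs with h
        exacts [hρ l h, le_rfl]
      · by_cases h : l ∈ B t
        · exact (hlt l h).le
        · simp [h] at hl
      · rw [← Finset.sum_subset hsub]
        · rw [hsum]
          exact Finset.sum_congr rfl fun l hl => by simp [hl]
        · intro l _ hl
          simp [hl]

end PosBasis

/-- The piecewise linear function with slope `a` on `[0, ∞)` and slope `b` on `(-∞, 0]`. -/
def piecewiseSlope (a b x : ℝ) : ℝ := if 0 ≤ x then a * x else b * x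

section PiecewiseSlope

variable {a b x : ℝ}

theorem piecewiseSlope_of_nonneg (h : 0 ≤ x) : piecewiseSlope a b x = a * x := if_pos h

theorem piecewiseSlope_of_nonpos (h : x ≤ 0) : piecewiseSlope a b x = b * x := by
  rcases h.eq_or_lt with rfl | h
  · simp [piecewiseSlope]
  · exact if_neg (not_le.2 h)

theorem piecewiseSlope_sub_mem {x y : ℝ} (hxy : x ≤ y) :
    min a b * (y - x) ≤ piecewiseSlope a b y - piecewiseSlope a b x ∧
      piecewiseSlope a b y - piecewiseSlope a b x ≤ max a b * (y - x) := by
  have h1 := min_le_left a b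
  have h2 := min_le_right a b
  have h3 := le_max_left a b
  have h4 := le_max_right a b
  rcases le_total 0 x with hx | hx
  · rw [piecewiseSlope_of_nonneg hx, piecewiseSlope_of_nonneg (hx.trans hxy)]
    constructor <;> nlinarith
  rcases le_total 0 y with hy | hy
  · rw [piecewiseSlope_of_nonpos hx, piecewiseSlope_of_nonneg hy]
    constructor <;> nlinarith
  · rw [piecewiseSlope_of_nonpos hx, piecewiseSlope_of_nonpos hy]
    constructor <;> nlinarith

theorem lipschitzWith_piecewiseSlope (ha : 0 ≤ a) (hb : 0 ≤ b) :
    LipschitzWith (max a b).toNNReal (piecewiseSlope a b) := by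
  refine LipschitzWith.of_le_add_mul' _ fun x y => ?_
  have hM : 0 ≤ max a b := le_max_of_le_left ha
  rw [Real.dist_eq]
  rcases le_total x y with h | h
  · have h1 := (piecewiseSlope_sub_mem (a := a) (b := b) h).1
    have h2 : 0 ≤ min a b * (y - x) := mul_nonneg (le_min ha hb) (sub_nonneg.2 h)
    have h3 := mul_nonneg hM (abs_nonneg (x - y))
    linarith
  · have h1 := (piecewiseSlope_sub_mem (a := a) (b := b) h).2
    rw [abs_of_nonneg (sub_nonneg.2 h)]
    linarith

theorem isClassKe_piecewiseSlope (ha : 0 < a) (hb : 0 < b) : IsClassKe (piecewiseSlope a b) where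
  continuous := (lipschitzWith_piecewiseSlope ha.le hb.le).continuous
  strictMono x y hxy := by
    have h1 := (piecewiseSlope_sub_mem (a := a) (b := b) hxy.le).1
    have h2 : 0 < min a b * (y - x) := mul_pos (lt_min ha hb) (sub_pos.2 hxy)
    linarith
  map_zero := by simp [piecewiseSlope]

theorem leftInverse_piecewiseSlope (ha : 0 < a) (hb : 0 < b) :
    Function.LeftInverse (piecewiseSlope a⁻¹ b⁻¹) (piecewiseSlope a b) := by
  intro x
  rcases le_total 0 x with hx | hx
  · rw [piecewiseSlope_of_nonneg hx, piecewiseSlope_of_nonneg (mul_nonneg ha.le hx),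
      inv_mul_cancel_left₀ ha.ne']
  · rw [piecewiseSlope_of_nonpos hx, piecewiseSlope_of_nonpos
      (mul_nonpos_of_nonneg_of_nonpos hb.le hx), inv_mul_cancel_left₀ hb.ne']

end PiecewiseSlope

/-! ### Construction of admissible data -/

namespace Design

variable {n N : ℕ} [NeZero n] [NeZero N] {O : Obstacles n N} {da db dh dr vbar : ℝ}

-- Take `α` piecewise linear: a small slope `b` on the negative axis makes `α(-d_h)` harmless, and
-- the slope `a` on the positive axis is tuned independently so that both upper conditions hold with
-- equality for `d_f = d_b / 2`.
set_option maxHeartbeats 400000 in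
theorem exists_admissible (hdist : O.DistanceCondition da db dh) (hdr : 0 < dr)
    (hvbar : 2 * dr < vbar)
    (hcond : 1 - (vbar - 2 * dr) ^ 2 / (2 * (vbar - dr) ^ 2)
      < (2 * O.dmin ^ 2 - da ^ 2) / (2 * (O.dmax + db / 2) ^ 2)) :
    ∃ D : Design n, D.Admissible O da db dh dr vbar := by
  obtain ⟨c, hc, hc1⟩ :=
    exists_between (Obstacles.sqrt_cstar_add_sqrt_lt_one hdist hdr hvbar hcond)
  have hc0 : 0 < c := lt_of_le_of_lt (by positivity) hc
  obtain ⟨B, hB⟩ := exists_isPosBasis (n := n) hc1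
  have hκ := Obstacles.gap_pos hdist hdr hvbar
  have hκm := Obstacles.gap_mul hdist hdr hvbar
  set κ := O.gap da db dr vbar with hκdef
  have hv : 0 < vbar - dr := by linarith
  have hdb := hdist.db_pos
  have hdh := hdist.dh_pos
  -- This strict inequality, from `c > √c* + √(c* + e)` and `gap_mul`, is the room in which `b` is
  -- chosen; half of it is spent.
  have hmain : dr < c * (vbar - dr) * κ := by
    have h1 : dr / (vbar - dr) < κ * c := by
      rw [← hκm]
      exact mul_lt_mul_of_pos_left hc hκ
    rw [div_lt_iff₀ hv] at h1
    linarith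
  obtain ⟨b, hb, hbdh⟩ : ∃ b, 0 < b ∧ c * (b * dh) = (c * (vbar - dr) * κ - dr) / 2 := by
    refine ⟨(c * (vbar - dr) * κ - dr) / 2 / (c * dh), ?_, ?_⟩
    · have : 0 < c * (vbar - dr) * κ - dr := by linarith
      positivity
    · field_simp
  obtain ⟨a, ha, hadb⟩ : ∃ a, 0 < a ∧ a * (db / 2) = vbar - dr + dr / c :=
    ⟨(vbar - dr + dr / c) / (db / 2), by positivity, by field_simp⟩
  have hab : 0 < a⁻¹ ∧ 0 < b⁻¹ := ⟨inv_pos.2 ha, inv_pos.2 hb⟩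
  have hαdb : c * piecewiseSlope a b (db / 2) - dr = c * (vbar - dr) := by
    rw [piecewiseSlope_of_nonneg (by positivity), hadb]
    field_simp
    ring
  have hαdh : dr - c * piecewiseSlope a b (-dh) < c * (vbar - dr) * κ := by
    rw [piecewiseSlope_of_nonpos (by linarith)]
    linarith
  have hinvmono := (isClassKe_piecewiseSlope hab.1 hab.2).strictMono
  have hleft := leftInverse_piecewiseSlope ha hb
  have hright : Function.RightInverse (piecewiseSlope a⁻¹ b⁻¹) (piecewiseSlope a b) := by
    have := leftInverse_piecewiseSlope hab.1 hab.2
    rwa [inv_inv, inv_inv] at this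
  have hsmall : ∀ p ∈ Set.Icc 0 dh, (dr - c * piecewiseSlope a b (-p)) / κ ≤ c * (vbar - dr) := by
    intro p hp
    rw [div_le_iff₀ hκ]
    have := mul_le_mul_of_nonneg_left ((isClassKe_piecewiseSlope ha hb).strictMono.monotone
      (neg_le_neg hp.2)) hc0.le
    linarith
  have hzero : ∀ p ∈ Set.Icc 0 dh,
      ∀ K ∈ ({c * (vbar - dr), (dr - c * piecewiseSlope a b (-p)) / κ} : Set ℝ),
        K ≤ c * (vbar - dr) ∧ piecewiseSlope a⁻¹ b⁻¹ ((-K * κ + dr) / c) + p ≤ 0 := by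
    intro p hp K hK
    have hKle : (dr - c * piecewiseSlope a b (-p)) / κ ≤ K ∧ K ≤ c * (vbar - dr) := by
      rcases hK with rfl | rfl
      exacts [⟨hsmall p hp, le_rfl⟩, ⟨le_rfl, hsmall p hp⟩]
    refine ⟨hKle.2, ?_⟩
    have h1 : (-K * κ + dr) / c ≤ piecewiseSlope a b (-p) := by
      rw [div_le_iff₀ hc0]
      have := (div_le_iff₀ hκ).1 hKle.1
      linarith
    have h2 := hinvmono.monotone h1
    rw [hleft] at h2
    linarith
  -- At `s = c` the lower bound required of `φ` is at most `0` by `hzero`. Its slope in `c - s` is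
  -- at most `max a⁻¹ b⁻¹ * (vbar - dr)`, since `K ≤ c(v̄ - d_r)`; the added `1` makes the
  -- inequality strict.
  set M := max a⁻¹ b⁻¹ * (vbar - dr) + 1 with hM
  have hMpos : 0 < M := by
    have : 0 < max a⁻¹ b⁻¹ := lt_max_of_lt_left hab.1
    positivity
  refine ⟨⟨c, fun s => M * max (c - s) 0, piecewiseSlope a b, piecewiseSlope a⁻¹ b⁻¹, db / 2, B⟩,
    ?_⟩
  exact
    { c₀_pos := hc0
      c₀_lt_one := hc1
      basis := hB
      φ_lipschitz := by
        refine ⟨M.toNNReal, LipschitzWith.lipschitzOnWith (LipschitzWith.of_le_add_mul' _ ?_)⟩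
        intro x y
        rw [Real.dist_eq, ← mul_add]
        refine mul_le_mul_of_nonneg_left (max_le ?_ ?_) hMpos.le
        · linarith [le_max_left (c - y) 0, neg_abs_le (x - y)]
        · linarith [le_max_right (c - y) 0, abs_nonneg (x - y)]
      φ_nonneg := fun s _ => mul_nonneg hMpos.le (le_max_right _ _)
      φ_decreasing := fun x _ y _ hxy =>
        mul_le_mul_of_nonneg_left (max_le_max (by linarith) le_rfl) hMpos.le
      α_classKe := isClassKe_piecewiseSlope ha hb
      α_lipschitz := ⟨_, lipschitzWith_piecewiseSlope ha.le hb.le⟩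
      αinv_left := hleft
      αinv_right := hright
      αinv_lipschitz := ⟨_, lipschitzWith_piecewiseSlope hab.1.le hab.2.le⟩
      c₀_large := hc
      α_upper := hαdb.le
      α_lower := by
        dsimp only
        rw [hαdb, ← hκdef, div_lt_iff₀ hκ]
        exact hαdh
      φ_large := by
        intro s hs p hp K hK
        obtain ⟨hK1, hK2⟩ := hzero p hp K hK
        have hs' : 0 < c - s := sub_pos.2 hs.2
        have hK0 : 0 ≤ K := by
          rcases hK with rfl | rfl
          · positivity
          · have := mul_nonpos_of_nonneg_of_nonpos hc0.le (show piecewiseSlope a b (-p) ≤ 0 by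
              rw [piecewiseSlope_of_nonpos (by linarith [hp.1])]
              nlinarith [hp.1])
            exact div_nonneg (by dsimp only; linarith) hκ.le
        have h1 := (piecewiseSlope_sub_mem (a := a⁻¹) (b := b⁻¹) (show (-K * κ + dr) / c ≤
          -K * (s - c) / c + (-K * κ + dr) / c by
            have : 0 ≤ -K * (s - c) / c := div_nonneg (by nlinarith) hc0.le
            linarith)).2
        have h2 : -K * (s - c) / c ≤ (vbar - dr) * (c - s) := by
          rw [div_le_iff₀ hc0]
          nlinarith
        have h3 : max a⁻¹ b⁻¹ * (-K * (s - c) / c) ≤ max a⁻¹ b⁻¹ * ((vbar - dr) * (c - s)) :=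
          mul_le_mul_of_nonneg_left h2 (le_max_of_le_left hab.1.le)
        dsimp only
        rw [← hκdef, max_eq_left hs'.le, hM]
        rw [add_sub_cancel_right] at h1
        nlinarith
      φ_zero := fun s hs => by
        dsimp only
        rw [max_eq_right (by linarith [hs.1]), mul_zero]
      df_pos := by positivity
      df_lower := by
        dsimp only
        rw [← hleft (db / 2), ← hκdef]
        apply hinvmono
        rw [div_lt_iff₀ (mul_pos hc0 hκ)]
        have : piecewiseSlope a b (db / 2) * (c * κ) = (c * (vbar - dr) + dr) * κ := by
          rw [← hαdb]
          ring
        rw [this]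
        linarith
      df_upper := by
        dsimp only
        rw [← hleft (db / 2)]
        apply hinvmono.monotone
        rw [piecewiseSlope_of_nonneg (by positivity), hadb]
        apply le_of_eq
        field_simp
        ring }

end Design

/-! ### Upper bounds for generalized directional derivatives -/

section UpperRate

variable {F : Type*} [NormedAddCommGroup F] [NormedSpace ℝ F] {f : F → ℝ} {x v : F} {c : ℝ}

/-- The difference quotients of `f` near `x` in the direction `v` are asymptotically at most
`c`. -/
def HasUpperRate (f : F → ℝ) (x v : F) (c : ℝ) : Prop :=
  ∀ c', c < c' → ∀ᶠ p : F × ℝ in 𝓝 x ×ˢ 𝓝[>] (0 : ℝ), (f (p.1 + p.2 • v) - f p.1) / p.2 ≤ c'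

theorem HasUpperRate.mono (h : HasUpperRate f x v c) {c₁ : ℝ} (hc : c ≤ c₁) :
    HasUpperRate f x v c₁ := fun c' hc' => h c' (hc.trans_lt hc')

theorem HasUpperRate.genDirDeriv_le (h : HasUpperRate f x v c) : genDirDeriv f x v ≤ c := by
  have key : ∀ c' : ℝ, c < c' → genDirDeriv f x v ≤ (c' : EReal) := fun c' hc' =>
    Filter.limsup_le_of_le (h := (h c' hc').mono fun p hp => EReal.coe_le_coe_iff.2 hp)
  refine le_of_forall_gt_imp_ge_of_dense fun y hy => ?_
  obtain ⟨z, hz, hzy⟩ := EReal.lt_iff_exists_real_btwn.1 hy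
  exact (key z (EReal.coe_lt_coe_iff.1 hz)).trans hzy.le

theorem HasUpperRate.apply_le_of_mem_genGradient (h : HasUpperRate f x v c) {δ : F →L[ℝ] ℝ}
    (hδ : δ ∈ genGradient f x) : δ v ≤ c :=
  EReal.coe_le_coe_iff.1 ((hδ v).trans h.genDirDeriv_le)

theorem eventually_snd_pos {F : Type*} [TopologicalSpace F] {x : F} :
    ∀ᶠ p : F × ℝ in 𝓝 x ×ˢ 𝓝[>] (0 : ℝ), 0 < p.2 :=
  tendsto_snd.eventually self_mem_nhdsWithin

theorem tendsto_fst_add_snd_smul :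
    Tendsto (fun p : F × ℝ => p.1 + p.2 • v) (𝓝 x ×ˢ 𝓝[>] (0 : ℝ)) (𝓝 x) := by
  have h2 : Tendsto (fun p : F × ℝ => p.2) (𝓝 x ×ˢ 𝓝[>] (0 : ℝ)) (𝓝 0) :=
    tendsto_snd.mono_right nhdsWithin_le_nhds
  simpa using tendsto_fst.add (h2.smul_const v)

theorem HasUpperRate.of_tendsto {Φ : F × ℝ → ℝ} (hΦ : Tendsto Φ (𝓝 x ×ˢ 𝓝[>] (0 : ℝ)) (𝓝 c))
    (hle : ∀ᶠ p : F × ℝ in 𝓝 x ×ˢ 𝓝[>] (0 : ℝ), (f (p.1 + p.2 • v) - f p.1) / p.2 ≤ Φ p) :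
    HasUpperRate f x v c := fun c' hc' => by
  filter_upwards [hle, hΦ.eventually_lt_const hc'] with p h1 h2
  exact h1.trans h2.le

/-- For a maximum of finitely many continuous functions only the active ones matter. -/
theorem HasUpperRate.of_max {ι : Type*} [Finite ι] {g : ι → F → ℝ} (hle : ∀ i y, g i y ≤ f y)
    (hex : ∀ y, ∃ i, f y = g i y) (hcont : ∀ i, ContinuousAt (g i) x)
    (h : ∀ i, g i x = f x → HasUpperRate (g i) x v c) : HasUpperRate f x v c := by
  intro c' hc'
  obtain ⟨k, hk⟩ := hex x
  -- A component inactive at `x` stays below an active one at the displaced point too, so it cannot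
  -- realize the maximum there.
  have hact : ∀ i, ∀ᶠ p : F × ℝ in 𝓝 x ×ˢ 𝓝[>] (0 : ℝ),
      f (p.1 + p.2 • v) = g i (p.1 + p.2 • v) → (g i (p.1 + p.2 • v) - g i p.1) / p.2 ≤ c' := by
    intro i
    rcases (hle i x).eq_or_lt with hi | hi
    · exact (h i hi c' hc').mono fun p hp _ => hp
    · rw [hk] at hi
      have h1 := (hcont i).tendsto.comp (tendsto_fst_add_snd_smul (x := x) (v := v))
      have h2 := (hcont k).tendsto.comp (tendsto_fst_add_snd_smul (x := x) (v := v))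
      filter_upwards [h1.eventually_lt h2 hi] with p hp hfp
      exact absurd (hle k (p.1 + p.2 • v)) (not_le.2 (hfp ▸ hp))
  filter_upwards [eventually_all.2 hact, eventually_snd_pos] with p hp hp0
  obtain ⟨i, hi⟩ := hex (p.1 + p.2 • v)
  refine le_trans ?_ (hp i hi)
  rw [hi]
  gcongr
  exact hle i p.1

theorem LipschitzNear.of_max {F ι : Type*} [NormedAddCommGroup F] {f : F → ℝ} {x : F} [Finite ι]
    {g : ι → F → ℝ} (hle : ∀ i y, g i y ≤ f y)
    (hex : ∀ y, ∃ i, f y = g i y) (h : ∀ i, LipschitzNear (g i) x) : LipschitzNear f x := by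
  choose K U hU hK using h
  obtain ⟨K₀, hK₀⟩ := (Set.finite_range K).bddAbove
  refine ⟨K₀, ⋂ i, U i, iInter_mem.2 hU, LipschitzOnWith.of_le_add_mul _ fun y hy z hz => ?_⟩
  obtain ⟨i, hi⟩ := hex y
  have h1 := ((hK i).weaken (hK₀ ⟨i, rfl⟩)).le_add_mul (Set.mem_iInter.1 hy i)
    (Set.mem_iInter.1 hz i)
  linarith [hle i z]

theorem LipschitzNear.continuousAt {F : Type*} [NormedAddCommGroup F] {f : F → ℝ} {x : F}
    (h : LipschitzNear f x) : ContinuousAt f x := by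
  obtain ⟨K, U, hU, hK⟩ := h
  exact hK.continuousOn.continuousAt hU

end UpperRate

/-- Difference quotients of a strictly differentiable function. -/
theorem HasStrictFDerivAt.tendsto_quotient {F G : Type*} [NormedAddCommGroup F] [NormedSpace ℝ F]
    {f : F → ℝ} {f' : F →L[ℝ] ℝ} {x : F} (hf : HasStrictFDerivAt f f' x) (v : F) {l : Filter G}
    {y : G → F} {t : G → ℝ} (hy : Tendsto y l (𝓝 x)) (ht : Tendsto t l (𝓝[>] 0)) :
    Tendsto (fun p => (f (y p + t p • v) - f (y p)) / t p) l (𝓝 (f' v)) := by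
  have ht0 : Tendsto t l (𝓝 0) := ht.mono_right nhdsWithin_le_nhds
  have htpos : ∀ᶠ p in l, 0 < t p := ht.eventually self_mem_nhdsWithin
  have hpair : Tendsto (fun p => (y p + t p • v, y p)) l (𝓝 (x, x)) := by
    refine Tendsto.prodMk_nhds ?_ hy
    simpa using hy.add (ht0.smul_const v)
  have h1 := hf.isLittleO.comp_tendsto hpair
  have h2 : ((fun p : F × F => p.1 - p.2) ∘ fun p => (y p + t p • v, y p)) =O[l] t := by
    refine Asymptotics.IsBigO.of_bound ‖v‖ (Eventually.of_forall fun p => ?_)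
    simp [norm_smul, mul_comm]
  have h3 := (h1.trans_isBigO h2).tendsto_div_nhds_zero
  have h4 := h3.add_const (f' v)
  rw [zero_add] at h4
  refine h4.congr' (htpos.mono fun p hp => ?_)
  simp only [Function.comp, add_sub_cancel_left, map_smul, smul_eq_mul]
  field_simp
  ring

/-! ### Matrix-vector products -/

section MatVec

variable {n : ℕ} (A B : Matrix (Fin n) (Fin n) ℝ) (x y : Vec n)

theorem inner_matVec : inner ℝ x (matVec A y) = x.ofLp ⬝ᵥ A.mulVec y.ofLp := by
  rw [matVec, EuclideanSpace.inner_eq_star_dotProduct, dotProduct_comm]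
  rfl

theorem matVec_add : matVec A (x + y) = matVec A x + matVec A y := by
  simp [matVec, Matrix.mulVec_add]

theorem matVec_sub : matVec A (x - y) = matVec A x - matVec A y := by
  simp [matVec, Matrix.mulVec_sub]

theorem matVec_smul (c : ℝ) : matVec A (c • x) = c • matVec A x := by
  simp [matVec, Matrix.mulVec_smul]

theorem sub_matVec : matVec (A - B) x = matVec A x - matVec B x := by
  simp [matVec, Matrix.sub_mulVec]

theorem smul_matVec (c : ℝ) : matVec (c • A) x = c • matVec A x := by
  simp [matVec, Matrix.smul_mulVec]

theorem one_matVec : matVec 1 x = x := by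
  simp [matVec]

theorem inner_transpose_matVec : inner ℝ x (matVec A.transpose y) = inner ℝ y (matVec A x) := by
  rw [inner_matVec, inner_matVec, Matrix.mulVec_transpose, dotProduct_comm,
    Matrix.dotProduct_mulVec]

theorem inner_matVec_comm {A : Matrix (Fin n) (Fin n) ℝ} (hA : A.IsSymm) :
    inner ℝ x (matVec A y) = inner ℝ y (matVec A x) := by
  rw [← inner_transpose_matVec, hA.eq]

theorem inner_sub_matVec_half_add {A : Matrix (Fin n) (Fin n) ℝ} (hA : A.IsSymm) :
    inner ℝ (x - y) (matVec A ((1 / 2 : ℝ) • (x + y)))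
      = 1 / 2 * inner ℝ x (matVec A x) - 1 / 2 * inner ℝ y (matVec A y) := by
  rw [matVec_smul, matVec_add, inner_smul_right, inner_add_right, inner_sub_left, inner_sub_left,
    inner_matVec_comm y x hA]
  ring

/-- The increment splits as `½ e₁ᵀ(M₁ - M₀)e₁ + (e₁ - e₀)ᵀM₀(e₁ + e₀)/2`. The error `e` is thus
never differentiated, being merely Lipschitz; only its increment is compared with `t • a`. -/
theorem energy_quotient_le {M₁ M₀ : Matrix (Fin n) (Fin n) ℝ} (hM₀ : M₀.IsSymm)
    {e₁ e₀ a : Vec n} {t b : ℝ} (ht : 0 < t) (hinc : ‖e₁ - e₀ - t • a‖ ≤ t * b) :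
    (1 / 2 * inner ℝ e₁ (matVec M₁ e₁) - 1 / 2 * inner ℝ e₀ (matVec M₀ e₀)) / t ≤
      1 / 2 * inner ℝ e₁ (matVec (t⁻¹ • (M₁ - M₀)) e₁)
        + inner ℝ a (matVec M₀ ((1 / 2 : ℝ) • (e₁ + e₀)))
        + b * ‖matVec M₀ ((1 / 2 : ℝ) • (e₁ + e₀))‖ := by
  have h1 := (real_inner_le_norm (e₁ - e₀ - t • a)
    (matVec M₀ ((1 / 2 : ℝ) • (e₁ + e₀)))).trans
    (mul_le_mul_of_nonneg_right hinc (norm_nonneg _))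
  rw [inner_sub_left, inner_smul_left, conj_trivial, inner_sub_matVec_half_add e₁ e₀ hM₀] at h1
  rw [smul_matVec, inner_smul_right, sub_matVec, inner_sub_right, div_le_iff₀ ht]
  have h2 : t⁻¹ * t = 1 := inv_mul_cancel₀ ht.ne'
  linear_combination h1 + (1 / 2) * (-(inner ℝ e₁ (matVec M₁ e₁)
    - inner ℝ e₁ (matVec M₀ e₁))) * h2

theorem inner_matVec_self_of_skew {A : Matrix (Fin n) (Fin n) ℝ} (hA : A + A.transpose = 0) :
    inner ℝ x (matVec A x) = 0 := by
  have h1 := inner_transpose_matVec A x x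
  have h2 : matVec A.transpose x = (-1 : ℝ) • matVec A x := by
    rw [← smul_matVec, neg_one_smul, eq_neg_of_add_eq_zero_right hA]
  rw [h2, inner_smul_right] at h1
  linarith

theorem inner_matVec_nonneg {A : Matrix (Fin n) (Fin n) ℝ} (hA : A.PosDef) :
    0 ≤ inner ℝ x (matVec A x) := by
  rw [inner_matVec]
  simpa using hA.posSemidef.dotProduct_mulVec_nonneg x.ofLp

theorem continuous_matVec :
    Continuous fun p : Matrix (Fin n) (Fin n) ℝ × Vec n => matVec p.1 p.2 :=
  (PiLp.continuous_toLp 2 _).comp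
    (continuous_fst.matrix_mulVec ((PiLp.continuous_ofLp 2 _).comp continuous_snd))

theorem tendsto_matVec {G : Type*} {l : Filter G} {A : G → Matrix (Fin n) (Fin n) ℝ}
    {x : G → Vec n} {A₀ : Matrix (Fin n) (Fin n) ℝ} {x₀ : Vec n} (hA : Tendsto A l (𝓝 A₀))
    (hx : Tendsto x l (𝓝 x₀)) : Tendsto (fun p => matVec (A p) (x p)) l (𝓝 (matVec A₀ x₀)) :=
  (continuous_matVec.tendsto (A₀, x₀)).comp (hA.prodMk_nhds hx)

end MatVec

/-! ### Inertia bounds and the energy of the tracking error -/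

namespace ELSystem.Regular

variable {n : ℕ} {S : ELSystem n} {μ₁ μ₂ : ℝ}

theorem le_inner (hS : S.Regular μ₁ μ₂) (q e : Vec n) :
    μ₁ * ‖e‖ ^ 2 ≤ inner ℝ e (matVec (S.M q) e) := by
  have h := inner_matVec_nonneg e (hS.lower q)
  rw [sub_matVec, smul_matVec, one_matVec, inner_sub_right, inner_smul_right,
    real_inner_self_eq_norm_sq] at h
  linarith

theorem inner_le (hS : S.Regular μ₁ μ₂) (q e : Vec n) :
    inner ℝ e (matVec (S.M q) e) ≤ μ₂ * ‖e‖ ^ 2 := by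
  have h := inner_matVec_nonneg e (hS.upper q)
  rw [sub_matVec, smul_matVec, one_matVec, inner_sub_right, inner_smul_right,
    real_inner_self_eq_norm_sq] at h
  linarith

/-- For `w = Me`, nonnegativity of the form `M` at `μ₂e - w` gives `2μ₂|w|² ≤ μ₂²eᵀMe + wᵀMw ≤
μ₂³|e|² + μ₂|w|²`. -/
theorem norm_matVec_le (hS : S.Regular μ₁ μ₂) (q e : Vec n) :
    ‖matVec (S.M q) e‖ ≤ μ₂ * ‖e‖ := by
  have hμ := hS.upper_pos
  set w := matVec (S.M q) e with hw
  have h1 := hS.le_inner q (μ₂ • e - w)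
  have h2 := hS.inner_le q w
  have h3 := hS.inner_le q e
  rw [← hw] at h3
  rw [matVec_sub, matVec_smul, ← hw, inner_sub_left, inner_sub_right, inner_sub_right,
    inner_smul_left, inner_smul_left, inner_smul_right, inner_smul_right,
    inner_matVec_comm e w (hS.symm q), ← hw, real_inner_self_eq_norm_sq, conj_trivial] at h1
  have h4 : 0 ≤ μ₁ * ‖μ₂ • e - w‖ ^ 2 := mul_nonneg hS.lower_pos.le (sq_nonneg _)
  have h5 : ‖w‖ ^ 2 ≤ (μ₂ * ‖e‖) ^ 2 := by
    refine le_of_mul_le_mul_left (a := μ₂) ?_ hμ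
    nlinarith [mul_le_mul_of_nonneg_left h3 (sq_nonneg μ₂)]
  exact (pow_le_pow_iff_left₀ (norm_nonneg _) (by positivity) two_ne_zero).1 h5

theorem mu_le [NeZero n] (hS : S.Regular μ₁ μ₂) : μ₁ ≤ μ₂ := by
  have h := (hS.le_inner 0 (EuclideanSpace.single 0 1)).trans
    (hS.inner_le 0 (EuclideanSpace.single 0 1))
  simpa using h

/-- Generalized derivatives let the base point move, so strict differentiability is needed; it comes
from `M` being `C¹`. -/
theorem tendsto_quotient (hS : S.Regular μ₁ μ₂) {G : Type*} {l : Filter G} {y : G → Vec n}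
    {t : G → ℝ} {q : Vec n} (hy : Tendsto y l (𝓝 q)) (ht : Tendsto t l (𝓝[>] 0)) (qd : Vec n) :
    Tendsto (fun p => (t p)⁻¹ • (S.M (y p + t p • qd) - S.M (y p))) l (𝓝 (S.Mdot q qd)) := by
  refine tendsto_pi_nhds.2 fun i => tendsto_pi_nhds.2 fun j => ?_
  have h := ((hS.contDiff i j).contDiffAt (x := q)).hasStrictFDerivAt one_ne_zero
  refine (h.tendsto_quotient qd hy ht).congr fun p => ?_
  rw [div_eq_inv_mul]
  rfl

theorem continuous_M (hS : S.Regular μ₁ μ₂) : Continuous S.M :=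
  continuous_pi fun i => continuous_pi fun j => (hS.contDiff i j).continuous

theorem contDiff_energy (hS : S.Regular μ₁ μ₂) :
    ContDiff ℝ 1 fun p : Vec n × Vec n => (inner ℝ p.2 (matVec (S.M p.1) p.2) : ℝ) := by
  have e : (fun p : Vec n × Vec n => (inner ℝ p.2 (matVec (S.M p.1) p.2) : ℝ)) =
      fun p => ∑ i, p.2 i * ∑ j, S.M p.1 i j * p.2 j := by
    ext p
    rw [inner_matVec]
    rfl
  rw [e]
  have hc : ∀ i, ContDiff ℝ 1 fun p : Vec n × Vec n => p.2 i := fun i =>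
    ((EuclideanSpace.proj (𝕜 := ℝ) i).contDiff).comp contDiff_snd
  exact ContDiff.sum fun i _ => (hc i).mul (ContDiff.sum fun j _ =>
    ((hS.contDiff i j).comp contDiff_fst).mul (hc j))

/-- The rate of change of the kinetic energy of a velocity error `e` whose increments are
`a` up to an error of size `b`. -/
theorem hasUpperRate_energy (hS : S.Regular μ₁ μ₂) {e : Vec n × Vec n × Vec n → Vec n}
    {x v : Vec n × Vec n × Vec n} (he : ContinuousAt e x) {a : Vec n} {b : ℝ}
    (hinc : ∀ᶠ p : (Vec n × Vec n × Vec n) × ℝ in 𝓝 x ×ˢ 𝓝[>] (0 : ℝ),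
      ‖e (p.1 + p.2 • v) - e p.1 - p.2 • a‖ ≤ p.2 * b) :
    HasUpperRate (fun y => 1 / 2 * inner ℝ (e y) (matVec (S.M y.1) (e y))) x v
      (1 / 2 * inner ℝ (e x) (matVec (S.Mdot x.1 v.1) (e x))
        + inner ℝ a (matVec (S.M x.1) (e x)) + b * ‖matVec (S.M x.1) (e x)‖) := by
  set l := 𝓝 x ×ˢ 𝓝[>] (0 : ℝ) with hl
  have hy : Tendsto (fun p : (Vec n × Vec n × Vec n) × ℝ => p.1.1) l (𝓝 x.1) :=
    (continuous_fst.tendsto x).comp tendsto_fst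
  have hM1 := hS.tendsto_quotient hy (tendsto_snd (f := 𝓝 x) (g := 𝓝[>] (0 : ℝ))) v.1
  have hM0 := (hS.continuous_M.tendsto x.1).comp hy
  have he0 : Tendsto (fun p : (Vec n × Vec n × Vec n) × ℝ => e p.1) l (𝓝 (e x)) :=
    he.tendsto.comp tendsto_fst
  have he1 : Tendsto (fun p : (Vec n × Vec n × Vec n) × ℝ => e (p.1 + p.2 • v)) l (𝓝 (e x)) :=
    he.tendsto.comp tendsto_fst_add_snd_smul
  have hmid : Tendsto (fun p : (Vec n × Vec n × Vec n) × ℝ =>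
      (1 / 2 : ℝ) • (e (p.1 + p.2 • v) + e p.1)) l (𝓝 (e x)) := by
    have := (he1.add he0).const_smul (1 / 2 : ℝ)
    rwa [← two_smul ℝ (e x), smul_smul, one_div_mul_cancel two_ne_zero, one_smul] at this
  have hMe := (continuous_matVec.tendsto (S.M x.1, e x)).comp (hM0.prodMk_nhds hmid)
  have hT1 : Tendsto (fun p : (Vec n × Vec n × Vec n) × ℝ => (inner ℝ (e (p.1 + p.2 • v))
      (matVec (p.2⁻¹ • (S.M (p.1.1 + p.2 • v.1) - S.M p.1.1)) (e (p.1 + p.2 • v))) : ℝ)) l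
      (𝓝 (inner ℝ (e x) (matVec (S.Mdot x.1 v.1) (e x)))) :=
    Tendsto.inner he1 (tendsto_matVec hM1 he1)
  have hT2 : Tendsto (fun p : (Vec n × Vec n × Vec n) × ℝ =>
      matVec (S.M p.1.1) ((1 / 2 : ℝ) • (e (p.1 + p.2 • v) + e p.1))) l
      (𝓝 (matVec (S.M x.1) (e x))) :=
    tendsto_matVec hM0 hmid
  have hT3 : Tendsto (fun p : (Vec n × Vec n × Vec n) × ℝ => (inner ℝ a
      (matVec (S.M p.1.1) ((1 / 2 : ℝ) • (e (p.1 + p.2 • v) + e p.1))) : ℝ)) l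
      (𝓝 (inner ℝ a (matVec (S.M x.1) (e x)))) := Tendsto.inner tendsto_const_nhds hT2
  have hT := ((hT1.const_mul (1 / 2)).add hT3).add (hT2.norm.const_mul b)
  refine HasUpperRate.of_tendsto hT ?_
  filter_upwards [hinc, eventually_snd_pos] with p hp hp0
  exact energy_quotient_le (hS.symm p.1.1) hp0 hp

end ELSystem.Regular

/-! ### The closed loop -/

namespace Obstacles

variable {n N : ℕ} (O : Obstacles n N)

theorem continuous_h (i : Fin N) : Continuous (O.h i) :=
  (continuous_const.sub continuous_id).norm.sub continuous_const

/-- The barrier function `-h_i` increases at most at the rate `l_{oi}ᵀ q̇`. -/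
theorem hasUpperRate_neg_h {i : Fin N} {F : Type*} [NormedAddCommGroup F] [NormedSpace ℝ F]
    (π : F →L[ℝ] Vec n) {x v : F} (hx : 0 < ‖O.center i - π x‖) :
    HasUpperRate (fun y => -O.h i (π y)) x v (inner ℝ (O.dir i (π x)) (π v)) := by
  have hc : ContinuousAt (fun y : F => (inner ℝ (O.dir i (π y)) (π v) : ℝ)) x := by
    have h1 : ContinuousAt (fun y : F => O.center i - π y) x :=
      (continuous_const.sub π.continuous).continuousAt
    exact ((h1.norm.inv₀ hx.ne').smul h1).inner continuousAt_const
  have hev : ∀ᶠ y in 𝓝 x, 0 < ‖O.center i - π y‖ :=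
    ((continuous_const.sub π.continuous).norm.continuousAt).eventually_const_lt hx
  refine HasUpperRate.of_tendsto (hc.tendsto.comp tendsto_fst) ?_
  filter_upwards [tendsto_fst.eventually hev, eventually_snd_pos] with p hp hp0
  -- Convexity of the norm: the unit direction at the base point is a subgradient there, which
  -- bounds the new distance from below.
  have h1 := real_inner_le_norm (O.dir i (π p.1)) (O.center i - π (p.1 + p.2 • v))
  rw [O.norm_dir hp, one_mul, map_add, map_smul, ← sub_sub, inner_sub_right, inner_smul_right] at h1
  have h2 : inner ℝ (O.dir i (π p.1)) (O.center i - π p.1) = ‖O.center i - π p.1‖ := by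
    rw [dir, inner_smul_left, real_inner_self_eq_norm_sq, conj_trivial]
    field_simp
  rw [div_le_iff₀ hp0, Function.comp_apply, h, h, map_add, map_smul, ← sub_sub]
  linarith

end Obstacles

/-! ### The gain condition and linear decay rates -/

section Constants

variable {ν L μ₁ μ₂ A dr kD : ℝ}

/-- Here `ν` is the dimension. After division by the denominator of the offset, the third inequality
becomes `2·off < μ₁d_r²` and the fourth `μ₂B² < 2·off·k²`. -/
theorem gain_bounds (hν : 1 ≤ ν) (hL : 0 < L) (hμ₁ : 0 < μ₁) (hμ : μ₁ ≤ μ₂) (hA : 0 < A)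
    (hdr : 0 < dr) (hkD : 2 * ν * L * (μ₂ ^ 3 * (A + dr) / (μ₁ ^ 2 * dr)) < kD) :
    0 < kD - L * μ₂ ∧ 0 < μ₁ * kD - 2 * ν * L * μ₂ ^ 2 ∧
      2 * ν * L * μ₂ ^ 2 * A < dr * (μ₁ * kD - 2 * ν * L * μ₂ ^ 2) ∧
      L * μ₂ * A * (μ₁ * kD - 2 * ν * L * μ₂ ^ 2) < 2 * ν * μ₁ * dr * (kD - L * μ₂) ^ 2 := by
  have hμ₂ : 0 < μ₂ := hμ₁.trans_le hμ
  have hν0 : 0 < ν := by linarith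
  have h1 : 2 * ν * L * μ₂ ^ 3 * (A + dr) < kD * (μ₁ ^ 2 * dr) := by
    rw [mul_div_assoc', div_lt_iff₀ (by positivity)] at hkD
    linarith
  set T := μ₁ * kD - 2 * ν * L * μ₂ ^ 2 with hT
  have h2 : 2 * ν * L * μ₂ ^ 2 * A < dr * T := by
    refine lt_of_mul_lt_mul_left (a := μ₁) ?_ hμ₁.le
    have h3 : 2 * ν * L * μ₂ ^ 2 * (A + dr) * μ₁ ≤ 2 * ν * L * μ₂ ^ 2 * (A + dr) * μ₂ :=
      mul_le_mul_of_nonneg_left hμ (by positivity)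
    rw [hT]
    linarith
  have hTpos : 0 < T := by
    have : 0 < dr * T := lt_trans (by positivity) h2
    exact pos_of_mul_pos_right this hdr.le
  have h4 : T ≤ μ₁ * (kD - 2 * ν * L * μ₂) := by
    have : 2 * ν * L * μ₂ * μ₁ ≤ 2 * ν * L * μ₂ * μ₂ :=
      mul_le_mul_of_nonneg_left hμ (by positivity)
    rw [hT]
    linarith
  have h5 : 0 < kD - 2 * ν * L * μ₂ := pos_of_mul_pos_right (hTpos.trans_le h4) hμ₁.le
  have h6 : kD - 2 * ν * L * μ₂ ≤ kD - L * μ₂ := by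
    have : 1 * (L * μ₂) ≤ 2 * ν * (L * μ₂) := mul_le_mul_of_nonneg_right (by linarith) (by positivity)
    linarith
  have hk : 0 < kD - L * μ₂ := h5.trans_le h6
  refine ⟨hk, hTpos, h2, ?_⟩
  have h7 : L * μ₂ * A * (2 * ν * μ₂ ^ 2) < dr * μ₂ ^ 2 * (kD - L * μ₂) := by
    have e1 : kD * μ₁ ^ 2 ≤ kD * μ₂ ^ 2 := by
      refine mul_le_mul_of_nonneg_left (pow_le_pow_left₀ hμ₁.le hμ 2) ?_
      have : 0 < L * μ₂ := by positivity
      linarith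
    have e2 := mul_le_mul_of_nonneg_left e1 hdr.le
    have e3 := mul_le_mul_of_nonneg_left h6 (show 0 ≤ dr * μ₂ ^ 2 by positivity)
    linarith
  have h8 : T ≤ μ₁ * (kD - L * μ₂) := h4.trans (mul_le_mul_of_nonneg_left h6 hμ₁.le)
  have h9 : L * μ₂ * A < dr * (kD - L * μ₂) := by
    refine lt_of_mul_lt_mul_right (a := 2 * ν * μ₂ ^ 2) ?_ (by positivity)
    have : 1 * (dr * μ₂ ^ 2 * (kD - L * μ₂)) ≤ 2 * ν * (dr * μ₂ ^ 2 * (kD - L * μ₂)) :=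
      mul_le_mul_of_nonneg_right (by linarith) (by positivity)
    linarith
  calc L * μ₂ * A * T ≤ L * μ₂ * A * (μ₁ * (kD - L * μ₂)) :=
        mul_le_mul_of_nonneg_left h8 (by positivity)
    _ < dr * (kD - L * μ₂) * (μ₁ * (kD - L * μ₂)) :=
        mul_lt_mul_of_pos_right h9 (by positivity)
    _ = 1 * (μ₁ * dr * (kD - L * μ₂) ^ 2) := by ring
    _ ≤ 2 * ν * (μ₁ * dr * (kD - L * μ₂) ^ 2) :=
        mul_le_mul_of_nonneg_right (by linarith) (by positivity)
    _ = _ := by ring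

/-- A linear decay rate for the barrier functions. -/
theorem exists_barrier_rate {off c₀ Kα : ℝ} {α : ℝ → ℝ} (hμ₁ : 0 < μ₁) (hdr : 0 < dr)
    (hoff : 2 * off < μ₁ * dr ^ 2) (hc₀ : 0 < c₀) (hc₁ : c₀ < 1)
    (hα0 : ∀ x, 0 ≤ x → 0 ≤ α x) (hαneg : ∀ x ≤ 0, α x ≤ 0) (hα : ∀ x, 0 ≤ x → α x ≤ Kα * x) :
    ∀ K, 0 < K → Kα ≤ K → ∃ d, 0 < d ∧ ∀ w ≤ d, ∀ s, 0 ≤ s → μ₁ * s ^ 2 ≤ 2 * (off + w) →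
      max (c₀ * α (-w) - dr) ((c₀ * α (-w) - dr) / c₀) + s ≤ -(K * w) := by
  intro K hK hKα
  -- `σ` slightly below `d_r` bounds the tracking error on all levels `w ≤ d`, leaving the positive
  -- margin `d_r - σ` that absorbs `K w` for small `w > 0`.
  obtain ⟨σ, hσ, hσ0, hσ1⟩ : ∃ σ, 2 * off < μ₁ * σ ^ 2 ∧ 0 < σ ∧ σ < dr := by
    have hc : ContinuousAt (fun σ : ℝ => μ₁ * σ ^ 2) dr := by fun_prop
    have := ((hc.eventually_const_lt hoff).filter_mono nhdsWithin_le_nhds).and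
      (Ioo_mem_nhdsLT hdr)
    exact this.exists
  have hσs : ∀ s, 0 ≤ s → μ₁ * s ^ 2 ≤ μ₁ * σ ^ 2 → s ≤ σ := fun s hs h =>
    (pow_le_pow_iff_left₀ hs hσ0.le two_ne_zero).1 (le_of_mul_le_mul_left h hμ₁)
  have hdrc : dr ≤ dr / c₀ := by
    rw [le_div_iff₀ hc₀]
    nlinarith
  refine ⟨min ((μ₁ * σ ^ 2 - 2 * off) / 2) ((dr - σ) / K),
    lt_min (by linarith) (div_pos (by linarith) hK), fun w hw s hs hsw => ?_⟩
  have hw1 := hw.trans (min_le_left _ _)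
  have hw2 := hw.trans (min_le_right _ _)
  rw [le_div_iff₀ hK] at hw2
  have hsσ : s ≤ σ := hσs s hs (by linarith)
  have hdiv : (c₀ * α (-w) - dr) / c₀ = α (-w) - dr / c₀ := by
    field_simp
  rw [hdiv]
  rcases le_total w 0 with h | h
  · have h1 := hα0 (-w) (by linarith)
    have h2 := hα (-w) (by linarith)
    have h3 : max (c₀ * α (-w) - dr) (α (-w) - dr / c₀) ≤ α (-w) - dr :=
      max_le (by nlinarith) (by linarith)
    nlinarith
  · have h1 := hαneg (-w) (by linarith)
    have h3 : max (c₀ * α (-w) - dr) (α (-w) - dr / c₀) ≤ -dr :=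
      max_le (by nlinarith) (by linarith)
    linarith

/-- A linear decay rate for the tracking error energy. -/
theorem exists_energy_rate {off k B : ℝ} (hμ₂ : 0 < μ₂) (hk : 0 < k) (hB : 0 < B)
    (hoff : μ₂ * B ^ 2 < 2 * off * k ^ 2) :
    ∃ K₀, ∀ K, 0 < K → K₀ ≤ K → ∃ d, 0 < d ∧ ∀ w ≤ d, ∀ s, 0 ≤ s →
      2 * (off + w) ≤ μ₂ * s ^ 2 → -(k * s ^ 2) + B * s ≤ -(K * w) := by
  -- Beyond `B / k` the quadratic term dominates; `τ` lies strictly beyond it, yet the energy `off`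
  -- at level `w = 0` still forces `s > τ`.
  obtain ⟨τ, hτ1, hτ⟩ : ∃ τ, μ₂ * τ ^ 2 < 2 * off ∧ B / k < τ := by
    have hc : ContinuousAt (fun τ : ℝ => μ₂ * τ ^ 2) (B / k) := by fun_prop
    have h0 : μ₂ * (B / k) ^ 2 < 2 * off := by
      rw [div_pow, mul_div_assoc', div_lt_iff₀ (by positivity)]
      exact hoff
    have := ((hc.eventually_lt_const h0).filter_mono nhdsWithin_le_nhds).and
      (self_mem_nhdsWithin (s := Set.Ioi (B / k)))
    exact this.exists
  have hτ0 : 0 < τ := (div_pos hB hk).trans hτ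
  rw [div_lt_iff₀ hk] at hτ
  set η := off - μ₂ * τ ^ 2 / 2 with hη
  have hη0 : 0 < η := by linarith
  -- For `w ≥ -η` the error is at least `τ` and the rate is uniformly negative. For `w < -η` the
  -- rate may be positive but never exceeds `B² / (4k)`, which `K ≥ K₀` makes at most `Kη`.
  refine ⟨B ^ 2 / (4 * k) / η, fun K hK hK0 => ⟨τ * (τ * k - B) / K,
    div_pos (mul_pos hτ0 (by linarith)) hK, fun w hw s hs hsw => ?_⟩⟩
  rw [le_div_iff₀ hK] at hw
  rcases le_or_gt (-η) w with h | h
  · have hsτ : τ ≤ s := by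
      refine (pow_le_pow_iff_left₀ hτ0.le hs two_ne_zero).1 (le_of_mul_le_mul_left ?_ hμ₂)
      linarith
    have h1 : τ * k - B ≤ s * k - B := by nlinarith
    have h2 : τ * (τ * k - B) ≤ s * (s * k - B) :=
      mul_le_mul hsτ h1 (by linarith) hs
    nlinarith
  · rw [div_le_iff₀ hη0] at hK0
    have h1 : -(k * s ^ 2) + B * s ≤ B ^ 2 / (4 * k) := by
      rw [le_div_iff₀ (by positivity)]
      nlinarith [sq_nonneg (2 * k * s - B)]
    nlinarith

end Constants

/-- The power balance of the tracking error. -/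
theorem ELSystem.Regular.power_balance {n : ℕ} {S : ELSystem n} {μ₁ μ₂ : ℝ}
    (hS : S.Regular μ₁ μ₂) {q qd qdd v : Vec n} {kD : ℝ}
    (hm : S.Motion q qd qdd (S.trackingInput kD q qd v)) :
    1 / 2 * inner ℝ (qd - v) (matVec (S.Mdot q qd) (qd - v))
      + inner ℝ qdd (matVec (S.M q) (qd - v)) = -(kD * ‖qd - v‖ ^ 2) := by
  have h1 : matVec (S.M q) qdd = -matVec (S.C q qd) (qd - v) - kD • (qd - v) := by
    rw [ELSystem.Motion, ELSystem.trackingInput] at hm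
    rw [matVec_sub]
    have h2 : matVec (S.M q) qdd = (matVec (S.M q) qdd + matVec (S.C q qd) qd + S.Nf q qd)
        - matVec (S.C q qd) qd - S.Nf q qd := by abel
    rw [h2, hm]
    abel
  -- Skew-symmetry cancels the Coriolis term against `½Ṁ`, leaving only the damping.
  have h3 := inner_matVec_self_of_skew (qd - v) (hS.skew q qd)
  rw [sub_matVec, smul_matVec, inner_sub_right, inner_smul_right] at h3
  rw [inner_matVec_comm qdd (qd - v) (hS.symm q), h1, inner_sub_right, inner_neg_right,
    inner_smul_right, real_inner_self_eq_norm_sq]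
  linarith

/-! ### Regularity and rates of the components of `W` -/

namespace Design

variable {n N : ℕ} {D : Design n} {O : Obstacles n N} {S : ELSystem n}
  {μ₁ μ₂ da db dh dr vbar vcd kD L Δ : ℝ}

/-- The velocity tracking error. -/
def trackingError (D : Design n) (O : Obstacles n N) (dr : ℝ) (x : Vec n × Vec n × Vec n) :
    Vec n := x.2.1 - D.outer O dr x.1 x.2.2

/-- The components of the Lyapunov-like function. -/
def Wcomp (D : Design n) (O : Obstacles n N) (S : ELSystem n) (μ₁ μ₂ vcd vbar dr kD L : ℝ) :
    Option (Fin N) → Vec n × Vec n × Vec n → ℝ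
  | none => D.Wlast O S μ₁ μ₂ vcd vbar dr kD L
  | some i => fun x => -O.h i x.1

theorem OuterLipschitz.norm_outer_sub_le (hL : D.OuterLipschitz O dr Δ L)
    {x y : Vec n × Vec n × Vec n} (hx : ∀ i, -Δ ≤ O.h i x.1) (hy : ∀ i, -Δ ≤ O.h i y.1) :
    ‖D.outer O dr x.1 x.2.2 - D.outer O dr y.1 y.2.2‖
      ≤ L * (‖x.1 - y.1‖ + ‖x.2.2 - y.2.2‖) :=
  hL _ _ (fun i => le_min (hx i) (hy i)) _ _

theorem eventually_le_h {x : Vec n × Vec n × Vec n} (hx : ∀ i, -Δ < O.h i x.1) :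
    ∀ᶠ y : Vec n × Vec n × Vec n in 𝓝 x, ∀ i, -Δ ≤ O.h i y.1 := by
  rw [eventually_all]
  intro i
  exact (((O.continuous_h i).comp continuous_fst).continuousAt.eventually_const_lt (hx i)).mono
    fun y hy => le_of_lt hy

theorem OuterLipschitz.lipschitzOnWith_trackingError (hL : D.OuterLipschitz O dr Δ L)
    (hL0 : 0 ≤ L) : LipschitzOnWith (1 + 2 * L).toNNReal (D.trackingError O dr)
      {y | ∀ i, -Δ ≤ O.h i y.1} := by
  refine LipschitzOnWith.of_dist_le_mul fun x hx y hy => ?_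
  rw [Real.coe_toNNReal _ (by positivity), dist_eq_norm, dist_eq_norm]
  have h1 := hL.norm_outer_sub_le hx hy
  have h2 : ‖x.1 - y.1‖ ≤ ‖x - y‖ := norm_fst_le (x - y)
  have h3 : ‖x.2 - y.2‖ ≤ ‖x - y‖ := norm_snd_le (x - y)
  have h4 : ‖x.2.1 - y.2.1‖ ≤ ‖x - y‖ := (norm_fst_le (x.2 - y.2)).trans h3
  have h5 : ‖x.2.2 - y.2.2‖ ≤ ‖x - y‖ := (norm_snd_le (x.2 - y.2)).trans h3
  have h6 : D.trackingError O dr x - D.trackingError O dr y = (x.2.1 - y.2.1)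
      - (D.outer O dr x.1 x.2.2 - D.outer O dr y.1 y.2.2) := by
    simp only [trackingError]
    abel
  have h7 := mul_le_mul_of_nonneg_left (add_le_add h2 h5) hL0
  calc _ ≤ ‖x.2.1 - y.2.1‖ + ‖D.outer O dr x.1 x.2.2 - D.outer O dr y.1 y.2.2‖ := by
        rw [h6]
        exact norm_sub_le _ _
    _ ≤ _ := by linarith

theorem OuterLipschitz.lipschitzNear_Wlast (hL : D.OuterLipschitz O dr Δ L) (hL0 : 0 ≤ L)
    (hS : S.Regular μ₁ μ₂) {L' : ℝ} {x : Vec n × Vec n × Vec n} (hx : ∀ i, -Δ < O.h i x.1) :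
    LipschitzNear (D.Wlast O S μ₁ μ₂ vcd vbar dr kD L') x := by
  have hU := eventually_le_h hx
  have he := hL.lipschitzOnWith_trackingError hL0
  have hpair : LipschitzOnWith (max 1 (1 + 2 * L).toNNReal)
      (fun y : Vec n × Vec n × Vec n => (y.1, D.trackingError O dr y))
      {y | ∀ i, -Δ ≤ O.h i y.1} :=
    LipschitzOnWith.prodMk (LipschitzWith.prod_fst.lipschitzOnWith) he
  have hG : ContDiff ℝ 1 fun p : Vec n × Vec n => -offset n μ₁ μ₂ vcd vbar dr kD L'
      + 1 / 2 * (inner ℝ p.2 (matVec (S.M p.1) p.2) : ℝ) :=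
    contDiff_const.add (contDiff_const.mul hS.contDiff_energy)
  obtain ⟨K, T, hT, hK⟩ :=
    (hG.contDiffAt (x := (x.1, D.trackingError O dr x))).exists_lipschitzOnWith
  have hcont := hpair.continuousOn.continuousAt hU
  have h := hK.comp (hpair.mono Set.inter_subset_left) (fun y hy => hy.2)
  exact ⟨_, _, inter_mem hU (hcont.preimage_mem_nhds hT), h⟩

/-- The rate of change of the last component along the closed loop. -/
theorem OuterLipschitz.hasUpperRate_Wlast (hL : D.OuterLipschitz O dr Δ L) (hL0 : 0 ≤ L)
    (hS : S.Regular μ₁ μ₂) {L' : ℝ} {q qd vc qdd vcdot : Vec n} (hx : ∀ i, -Δ < O.h i q)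
    (hm : S.Motion q qd qdd (S.trackingInput kD q qd (D.outer O dr q vc))) :
    HasUpperRate (D.Wlast O S μ₁ μ₂ vcd vbar dr kD L') (q, qd, vc) (qd, qdd, vcdot)
      (-(kD * ‖D.trackingError O dr (q, qd, vc)‖ ^ 2) + L * (‖qd‖ + ‖vcdot‖) *
        (μ₂ * ‖D.trackingError O dr (q, qd, vc)‖)) := by
  set x : Vec n × Vec n × Vec n := (q, qd, vc) with hxdef
  set v : Vec n × Vec n × Vec n := (qd, qdd, vcdot) with hvdef
  have hU : ∀ᶠ y : Vec n × Vec n × Vec n in 𝓝 x, ∀ i, -Δ ≤ O.h i y.1 := eventually_le_h hx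
  have he : ContinuousAt (D.trackingError O dr) x :=
    (hL.lipschitzOnWith_trackingError hL0).continuousOn.continuousAt hU
  -- Once `t • qdd` is removed, only the increment of the outer map remains, and `L` controls it.
  have hinc : ∀ᶠ p : (Vec n × Vec n × Vec n) × ℝ in 𝓝 x ×ˢ 𝓝[>] (0 : ℝ),
      ‖D.trackingError O dr (p.1 + p.2 • v) - D.trackingError O dr p.1 - p.2 • qdd‖
        ≤ p.2 * (L * (‖qd‖ + ‖vcdot‖)) := by
    filter_upwards [tendsto_fst.eventually hU, tendsto_fst_add_snd_smul.eventually hU,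
      eventually_snd_pos] with p h1 h2 h3
    have h4 := hL.norm_outer_sub_le h1 h2
    have e1 : (p.1 + p.2 • v).1 = p.1.1 + p.2 • qd := rfl
    have e2 : (p.1 + p.2 • v).2.1 = p.1.2.1 + p.2 • qdd := rfl
    have e3 : (p.1 + p.2 • v).2.2 = p.1.2.2 + p.2 • vcdot := rfl
    have e4 : D.trackingError O dr (p.1 + p.2 • v) - D.trackingError O dr p.1 - p.2 • qdd
        = D.outer O dr p.1.1 p.1.2.2
          - D.outer O dr (p.1 + p.2 • v).1 (p.1 + p.2 • v).2.2 := by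
      simp only [trackingError, e2]
      abel
    rw [e4]
    refine h4.trans (le_of_eq ?_)
    rw [e1, e3, sub_add_cancel_left, sub_add_cancel_left, norm_neg, norm_neg, norm_smul,
      norm_smul, Real.norm_eq_abs, abs_of_pos h3]
    ring
  have h := hS.hasUpperRate_energy he hinc
  have hbal := hS.power_balance hm
  have hc : 1 / 2 * inner ℝ (D.trackingError O dr x)
        (matVec (S.Mdot x.1 v.1) (D.trackingError O dr x))
      + inner ℝ qdd (matVec (S.M x.1) (D.trackingError O dr x))
      + L * (‖qd‖ + ‖vcdot‖) * ‖matVec (S.M x.1) (D.trackingError O dr x)‖ ≤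
      -(kD * ‖D.trackingError O dr x‖ ^ 2) + L * (‖qd‖ + ‖vcdot‖) *
        (μ₂ * ‖D.trackingError O dr x‖) := by
    refine add_le_add (le_of_eq hbal) ?_
    exact mul_le_mul_of_nonneg_left (hS.norm_matVec_le _ _) (by positivity)
  intro c' hc'
  filter_upwards [h.mono hc c' hc'] with p hp
  refine le_trans (le_of_eq ?_) hp
  congr 1
  exact add_sub_add_left_eq_sub _ _ _

variable [NeZero N]

theorem Wcomp_le (i : Option (Fin N)) (x : Vec n × Vec n × Vec n) :
    D.Wcomp O S μ₁ μ₂ vcd vbar dr kD L i x ≤ D.W O S μ₁ μ₂ vcd vbar dr kD L x := by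
  rcases i with _ | i
  · exact le_max_right _ _
  · exact le_max_of_le_left (Finset.le_sup' (fun i => -O.h i x.1) (Finset.mem_univ i))

theorem exists_W_eq (x : Vec n × Vec n × Vec n) :
    ∃ i, D.W O S μ₁ μ₂ vcd vbar dr kD L x = D.Wcomp O S μ₁ μ₂ vcd vbar dr kD L i x := by
  rw [W]
  rcases max_choice (Finset.univ.sup' Finset.univ_nonempty fun i => -O.h i x.1)
    (D.Wlast O S μ₁ μ₂ vcd vbar dr kD L x) with h | h
  · obtain ⟨i, -, hi⟩ := Finset.exists_mem_eq_sup' Finset.univ_nonempty fun i => -O.h i x.1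
    exact ⟨some i, h.trans hi⟩
  · exact ⟨none, h⟩

theorem OuterLipschitz.lipschitzNear_W (hL : D.OuterLipschitz O dr Δ L) (hL0 : 0 ≤ L)
    (hS : S.Regular μ₁ μ₂) {L' : ℝ} {x : Vec n × Vec n × Vec n} (hx : ∀ i, -Δ < O.h i x.1) :
    (∀ i, LipschitzNear (D.Wcomp O S μ₁ μ₂ vcd vbar dr kD L' i) x) ∧
      LipschitzNear (D.W O S μ₁ μ₂ vcd vbar dr kD L') x := by
  have h : ∀ i, LipschitzNear (D.Wcomp O S μ₁ μ₂ vcd vbar dr kD L' i) x := by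
    rintro (_ | i)
    · exact hL.lipschitzNear_Wlast hL0 hS hx
    · refine ⟨1, Set.univ, univ_mem, LipschitzWith.lipschitzOnWith ?_⟩
      refine LipschitzWith.of_dist_le_mul fun y z => ?_
      rw [NNReal.coe_one, one_mul, Real.dist_eq, dist_eq_norm]
      refine le_trans ?_ ((O.abs_h_sub_h_le i y.1 z.1).trans (norm_fst_le (y - z)))
      rw [← abs_neg]
      apply le_of_eq
      congr 1
      simp only [Wcomp]
      ring
  exact ⟨h, LipschitzNear.of_max Wcomp_le exists_W_eq h⟩

end Design

/-! ### Decay of `W` along the closed loop -/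

namespace Design

variable {n N : ℕ} [NeZero N] {D : Design n} {O : Obstacles n N} {S : ELSystem n}
  {μ₁ μ₂ da db dh dr vbar vcd kD L Δ : ℝ}

theorem Admissible.exists_decay [NeZero n] (hD : D.Admissible O da db dh dr vbar)
    (hS : S.Regular μ₁ μ₂) (hdr : 0 < dr) (hvbar : 2 * dr < vbar) (hvcd : 0 < vcd)
    (hΔ0 : 0 < Δ) (hΔ : Δ < O.dmin)
    (hfeas : ∀ q, (∀ i, -Δ ≤ O.h i q) → (D.feasible O dr q).Nonempty)
    (hL0 : 0 < L) (hL : D.OuterLipschitz O dr Δ L)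
    (hkD : 2 * n * L * (μ₂ ^ 3 * (vcd + vbar) / (μ₁ ^ 2 * dr)) < kD) :
    ∃ αw : ℝ → ℝ, IsClassKe αw ∧ IsLipschitz αw ∧ ∃ dw : ℝ, 0 < dw ∧
      ∀ q qd vc : Vec n, D.W O S μ₁ μ₂ vcd vbar dr kD L (q, qd, vc) ≤ dw →
        LipschitzNear (D.W O S μ₁ μ₂ vcd vbar dr kD L) (q, qd, vc) ∧
        ∀ qdd vcdot : Vec n,
          S.Motion q qd qdd (S.trackingInput kD q qd (D.outer O dr q vc)) →
          ‖vcdot‖ ≤ vcd →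
          ∀ δ ∈ genGradient (D.W O S μ₁ μ₂ vcd vbar dr kD L) (q, qd, vc),
            δ (qd, qdd, vcdot) ≤ -αw (D.W O S μ₁ μ₂ vcd vbar dr kD L (q, qd, vc)) := by
  have hμ₁ := hS.lower_pos
  have hμ₂ := hS.upper_pos
  have hn : (1 : ℝ) ≤ n := by exact_mod_cast NeZero.one_le
  set A := vcd + vbar - dr with hA
  have hA0 : 0 < A := by linarith
  obtain ⟨hk, hT, hb1, hb2⟩ := gain_bounds hn hL0 hμ₁ hS.mu_le hA0 hdr (kD := kD) (by
    rwa [hA, sub_add_cancel])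
  set off := offset n μ₁ μ₂ vcd vbar dr kD L with hoffdef
  set T := μ₁ * kD - 2 * n * L * μ₂ ^ 2 with hTdef
  have hoff : off * T = n * L * μ₁ * μ₂ ^ 2 * A * dr := by
    rw [hoffdef, offset, ← hTdef, ← hA, div_mul_cancel₀ _ hT.ne']
  have hoff1 : 2 * off < μ₁ * dr ^ 2 := by
    refine lt_of_mul_lt_mul_right (a := T) ?_ hT.le
    have := mul_lt_mul_of_pos_left hb1 (mul_pos hμ₁ hdr)
    linarith
  have hoff2 : μ₂ * (L * μ₂ * A) ^ 2 < 2 * off * (kD - L * μ₂) ^ 2 := by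
    refine lt_of_mul_lt_mul_right (a := T) ?_ hT.le
    have h1 := mul_lt_mul_of_pos_left hb2 (show 0 < L * μ₂ ^ 2 * A by positivity)
    have h2 : 2 * off * (kD - L * μ₂) ^ 2 * T = 2 * (off * T) * (kD - L * μ₂) ^ 2 := by ring
    rw [h2, hoff]
    linarith
  obtain ⟨Kα, hKα⟩ := hD.α_lipschitz
  have hαle : ∀ x, 0 ≤ x → D.α x ≤ Kα * x := by
    intro x hx
    have := hKα.norm_sub_le x 0
    rw [hD.α_classKe.map_zero, sub_zero, sub_zero, Real.norm_eq_abs, Real.norm_eq_abs,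
      abs_of_nonneg hx] at this
    exact (le_abs_self _).trans this
  obtain ⟨K₀, hK₀⟩ := exists_energy_rate hμ₂ hk (show 0 < L * μ₂ * A by positivity) hoff2
  -- A single slope large enough for both rates gives one linear `α_w` valid whichever component is
  -- active.
  obtain ⟨K, hK, hK1, hK2⟩ : ∃ K : ℝ, 0 < K ∧ Kα ≤ K ∧ K₀ ≤ K :=
    ⟨max 1 (max Kα K₀), lt_max_of_lt_left one_pos, le_max_of_le_right (le_max_left _ _),
      le_max_of_le_right (le_max_right _ _)⟩
  obtain ⟨d₁, hd₁, hbar⟩ := exists_barrier_rate hμ₁ hdr hoff1 hD.c₀_pos hD.c₀_lt_one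
    (fun x => hD.α_nonneg) (fun x => hD.α_nonpos) hαle K hK hK1
  obtain ⟨d₂, hd₂, hen⟩ := hK₀ K hK hK2
  -- Staying at level `Δ / 2` keeps `h i > -Δ` strictly, so a whole neighbourhood lies where the
  -- outer map is Lipschitz.
  refine ⟨fun w => K * w, ⟨by fun_prop, fun x y h => mul_lt_mul_of_pos_left h hK, mul_zero K⟩,
    ⟨K.toNNReal, LipschitzWith.of_dist_le_mul fun x y => ?_⟩, min (Δ / 2) (min d₁ d₂),
    by positivity, fun q qd vc hW => ?_⟩
  · rw [Real.coe_toNNReal _ hK.le, Real.dist_eq, Real.dist_eq, ← mul_sub, abs_mul, abs_of_pos hK]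
  have hW0 := hW.trans (min_le_left _ _)
  have hW1 := hW.trans ((min_le_right _ _).trans (min_le_left _ _))
  have hW2 := hW.trans ((min_le_right _ _).trans (min_le_right _ _))
  have hcomp := Wcomp_le (D := D) (O := O) (S := S) (μ₁ := μ₁) (μ₂ := μ₂) (vcd := vcd)
    (vbar := vbar) (dr := dr) (kD := kD) (L := L) (x := (q, qd, vc))
  set w := D.W O S μ₁ μ₂ vcd vbar dr kD L (q, qd, vc) with hw
  have hx : ∀ i, -Δ < O.h i q := by
    intro i
    have : -O.h i q ≤ w := hcomp (some i)
    linarith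
  have hpos : ∀ i, 0 < ‖O.center i - q‖ := fun i =>
    (sub_pos.2 hΔ).trans_le (O.le_norm_center_sub (hx i).le)
  obtain ⟨hlipc, hlip⟩ := hL.lipschitzNear_W hL0.le hS (vcd := vcd) (vbar := vbar) (kD := kD)
    (L' := L) (x := (q, qd, vc)) hx
  refine ⟨hlip, fun qdd vcdot hm hvc δ hδ => ?_⟩
  have hsol := isQPSolution_outer (hfeas q fun i => (hx i).le) vc
  set v := D.outer O dr q vc with hv
  have hvn : ‖v‖ ≤ vbar - dr := hD.norm_le_of_mem_feasible hsol.1 (by linarith)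
  set e := qd - v with he
  -- This bound needs no activity: the energy component is always below `w`, so `e` is small in the
  -- barrier case as well.
  have hEw : 1 / 2 * inner ℝ e (matVec (S.M q) e) ≤ off + w := by
    have h1 : -off + 1 / 2 * inner ℝ e (matVec (S.M q) e) ≤ w := hcomp none
    linarith
  refine HasUpperRate.apply_le_of_mem_genGradient (HasUpperRate.of_max Wcomp_le exists_W_eq
    (fun i => (hlipc i).continuousAt) ?_) hδ
  rintro (_ | i) hi
  · have hEw' : -off + 1 / 2 * inner ℝ e (matVec (S.M q) e) = w := hi
    refine (hL.hasUpperRate_Wlast hL0.le hS hx hm).mono ?_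
    have h1 := hen w hW2 ‖e‖ (norm_nonneg _) (by linarith [hS.inner_le q e])
    have hqd : ‖qd‖ ≤ ‖e‖ + (vbar - dr) := by
      have : qd = e + v := by rw [he, sub_add_cancel]
      rw [this]
      exact (norm_add_le _ _).trans (by linarith)
    refine le_trans ?_ h1
    change -(kD * ‖e‖ ^ 2) + L * (‖qd‖ + ‖vcdot‖) * (μ₂ * ‖e‖) ≤ _
    have h2 : L * (‖qd‖ + ‖vcdot‖) * (μ₂ * ‖e‖) ≤ L * (‖e‖ + A) * (μ₂ * ‖e‖) := by
      gcongr L * ?_ * (μ₂ * ‖e‖)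
      linarith
    linarith
  · have hi' : -O.h i q = w := hi
    refine (O.hasUpperRate_neg_h (ContinuousLinearMap.fst ℝ (Vec n) (Vec n × Vec n))
      (x := (q, qd, vc)) (v := (qd, qdd, vcdot)) (hpos i)).mono ?_
    change inner ℝ (O.dir i q) qd ≤ -(K * w)
    have h1 := hbar w hW1 ‖e‖ (norm_nonneg _) (by linarith [hS.le_inner q e])
    have h2 := hD.inner_dir_le hsol.1 (hpos i)
    rw [← hi', neg_neg] at h1
    rw [← hi']
    have h3 : inner ℝ (O.dir i q) qd = inner ℝ (O.dir i q) v + inner ℝ (O.dir i q) e := by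
      rw [← inner_add_right, he, add_sub_cancel]
    have h4 : inner ℝ (O.dir i q) e ≤ ‖e‖ := by
      refine (real_inner_le_norm _ _).trans ?_
      rw [O.norm_dir (hpos i), one_mul]
    linarith

end Design

end

/-! ### The theorem -/

theorem theorem2 {n N : ℕ} [NeZero n] [NeZero N]
    (S : ELSystem n) (μ₁ μ₂ : ℝ) (hS : S.Regular μ₁ μ₂)
    (O : Obstacles n N) (hO : ∀ i, 0 < O.margin i)
    (da db dh : ℝ) (hdist : O.DistanceCondition da db dh)
    (vcd : ℝ) (hvcd : 0 < vcd)
    (dr vbar : ℝ) (hdr : 0 < dr) (hvbar : 2 * dr < vbar)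
    (hda : da < √2 * O.dmin)
    (hcond : 1 - (vbar - 2 * dr) ^ 2 / (2 * (vbar - dr) ^ 2)
      < (2 * O.dmin ^ 2 - da ^ 2) / (2 * (O.dmax + db / 2) ^ 2)) :
    (∃ D : Design n, D.Admissible O da db dh dr vbar) ∧
    ∀ D : Design n, D.Admissible O da db dh dr vbar →
      ∃ Δh : ℝ, 0 < Δh ∧ Δh ≤ dh ∧
        (∀ q : Vec n, (∀ i, -Δh ≤ O.h i q) → ∀ vc : Vec n, ∃! v, D.IsQPSolution O dr q vc v) ∧
        (∃ L : ℝ, 0 < L ∧ D.OuterLipschitz O dr Δh L) ∧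
        ∀ L : ℝ, 0 < L → D.OuterLipschitz O dr Δh L →
          ∀ kD : ℝ, 2 * n * L * (μ₂ ^ 3 * (vcd + vbar) / (μ₁ ^ 2 * dr)) < kD →
            ∃ αw : ℝ → ℝ, IsClassKe αw ∧ IsLipschitz αw ∧ ∃ dw : ℝ, 0 < dw ∧
              ∀ q qd vc : Vec n, D.W O S μ₁ μ₂ vcd vbar dr kD L (q, qd, vc) ≤ dw →
                LipschitzNear (D.W O S μ₁ μ₂ vcd vbar dr kD L) (q, qd, vc) ∧
                ∀ qdd vcdot : Vec n,
                  S.Motion q qd qdd (S.trackingInput kD q qd (D.outer O dr q vc)) →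
                  ‖vcdot‖ ≤ vcd →
                  ∀ δ ∈ genGradient (D.W O S μ₁ μ₂ vcd vbar dr kD L) (q, qd, vc),
                    δ (qd, qdd, vcdot) ≤ -αw (D.W O S μ₁ μ₂ vcd vbar dr kD L (q, qd, vc)) := by
  refine ⟨Design.exists_admissible hdist hdr hvbar hcond, fun D hD => ?_⟩
  obtain ⟨Δ, hΔ0, hΔh, hdir⟩ := Obstacles.exists_norm_dir_sub_le hdist hD.c₀_large
  have hΔ : Δ < O.dmin := hΔh.trans_lt hdist.dh_lt
  have hfeas : ∀ q, (∀ i, -Δ ≤ O.h i q) → (D.feasible O dr q).Nonempty := fun q hq =>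
    hD.feasible_nonempty (Obstacles.gap_pos hdist hdr hvbar) hdr ⟨hΔ0.le, hΔh⟩ hq
      (fun i => (sub_pos.2 hΔ).trans_le (O.le_norm_center_sub (hq i))) (hdir q hq)
  exact ⟨Δ, hΔ0, hΔh, fun q hq vc => Design.existsUnique_isQPSolution (hfeas q hq) vc,
    hD.exists_outerLipschitz hΔ hfeas, fun L hL0 hL kD hkD =>
      hD.exists_decay hS hdr hvbar hvcd hΔ0 hΔ hfeas hL0 hL hkD⟩
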